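/- Let $\alpha\in\mathbb{R}$ and consider, for $t>0$ and $x\in\mathbb{R}$, the viscous transonic equation $$u_{tt}=-u_{xxx}+u_xu_{xx}-\frac{\alpha}{t}u_t .$$ Let $\mathcal F$ be the algebra of smooth real functions, each depending on finitely many of the variables $t>0$, $x$, $u_k=\partial_x^k u$, $v_k=\partial_x^k u_t$ ($k\ge 0$), all of which except $t$ range over $\mathbb{R}$. Put $F=-u_3+u_1u_2-\frac{\alpha}{t}v_0$ and let $$\bar D_x=\partial_x+\sum_{k\ge0}u_{k+1}\partial_{u_k}+\sum_{k\ge0}v_{k+1}\partial_{v_k},\qquad \bar D_t=\partial_t+\sum_{k\ge0}v_k\partial_{u_k}+\sum_{k\ge0}\bar D_x^k(F)\,\partial_{v_k}$$ be the total derivatives restricted to the equation. A conserved current is a pair $(J_0,J_1)\in\mathcal F^2$ with $\bar D_tJ_0+\bar D_xJ_1=0$; it is trivial if $J_0=-\bar D_x\mathcal L$, $J_1=\bar D_t\mathcal L$ for some $\mathcal L\in\mathcal F$; two conserved currents are equivalent if they differ by a trivial one, and a conservation law is an equivalence class of conserved currents. The characteristic of the conservation law of $(J_0,J_1)$ is $\chi=\sum_{k\ge0}(-1)^k\bar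 D_x^k\bigl(\partial J_0/\partial v_k\bigr)$. Then $$\Bigl(u_tt^\alpha,\;u_{xx}t^\alpha-\frac{u_x^2}{2}t^\alpha\Bigr)\quad\text{and}\quad \Bigl(u_tt+(\alpha-1)u,\;u_{xx}t-\frac{u_x^2}{2}t\Bigr)$$ are conserved currents, and every conserved current equivalent to the first (respectively, the second) has characteristic $t^\alpha$ (respectively, $t$). Moreover, if $\alpha\neq1$, then every conservation law of the equation is a linear combination with real constant coefficients of the conservation laws of these two currents; that is, every conserved current is equivalent to a real linear combination of them. -/

import Mathlib

open scoped ContDiff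

noncomputable section

namespace ViscousTransonic

/-- The coordinates on the infinite prolongation of `u_tt = -u_xxx + u_x u_xx - (α/t) u_t`:
the independent variables `t`, `x`, and the derivatives `u k = ∂ₓᵏ u` and `ut k = ∂ₓᵏ u_t`.
All other derivatives of `u` are expressed through these by the equation. -/
inductive Coord : Type
  | t : Coord
  | x : Coord
  | u : ℕ → Coord
  | ut : ℕ → Coord
  deriving DecidableEq

/-- The points of the prolonged equation: the coordinates take arbitrary real values,
subject only to `0 < t`. -/
abbrev JetSpace : Type := {p : Coord → ℝ // 0 < p Coord.t}

/-- The value of a coordinate, as a function on the prolonged equation. -/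
def coord (c : Coord) : JetSpace → ℝ := fun p => p.1 c

/-- Smooth functions on the prolonged equation that depend on finitely many coordinates only. -/
def IsSmoothFun (f : JetSpace → ℝ) : Prop :=
  ∃ (S : Finset Coord) (g : (S → ℝ) → ℝ),
    ContDiffOn ℝ ∞ g {q | ∀ h : Coord.t ∈ S, 0 < q ⟨Coord.t, h⟩} ∧
    ∀ p : JetSpace, f p = g (fun c => p.1 c)

/-- The partial derivative `∂f/∂c`. The extension of `f` by zero to `t ≤ 0` is immaterial,
since the derivative is only taken at points with `0 < t`. -/
def pd (c : Coord) (f : JetSpace → ℝ) : JetSpace → ℝ := fun p =>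
  deriv (fun s : ℝ => Function.extend Subtype.val f 0 (Function.update p.1 c s)) (p.1 c)

/-- The total derivative with respect to `x`, restricted to the equation. -/
def Dx (f : JetSpace → ℝ) : JetSpace → ℝ := fun p =>
  pd Coord.x f p
    + ∑ᶠ k : ℕ, coord (Coord.u (k + 1)) p * pd (Coord.u k) f p
    + ∑ᶠ k : ℕ, coord (Coord.ut (k + 1)) p * pd (Coord.ut k) f p

/-- The right-hand side `-u_xxx + u_x u_xx - (α/t) u_t` of the equation. -/
def rhs (α : ℝ) : JetSpace → ℝ := fun p =>
  -coord (Coord.u 3) p + coord (Coord.u 1) p * coord (Coord.u 2) p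
    - α / coord Coord.t p * coord (Coord.ut 0) p

/-- The total derivative with respect to `t`, restricted to the equation. -/
def Dt (α : ℝ) (f : JetSpace → ℝ) : JetSpace → ℝ := fun p =>
  pd Coord.t f p
    + ∑ᶠ k : ℕ, coord (Coord.ut k) p * pd (Coord.u k) f p
    + ∑ᶠ k : ℕ, (Dx^[k] (rhs α)) p * pd (Coord.ut k) f p

/-- Pairs `(J₀, J₁)` of functions on the prolonged equation; `J₀` is the `t`-component and
`J₁` the `x`-component. -/
abbrev Current : Type := (JetSpace → ℝ) × (JetSpace → ℝ)

/-- Conserved currents: pairs of smooth functions with `D_t J₀ + D_x J₁ = 0` on the equation. -/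
def IsConserved (α : ℝ) (J : Current) : Prop :=
  IsSmoothFun J.1 ∧ IsSmoothFun J.2 ∧ Dt α J.1 + Dx J.2 = 0

/-- Trivial currents: `J₀ = -D_x ℒ`, `J₁ = D_t ℒ` for a smooth function `ℒ` on the equation. -/
def IsTrivial (α : ℝ) (J : Current) : Prop :=
  ∃ L : JetSpace → ℝ, IsSmoothFun L ∧ J.1 = -Dx L ∧ J.2 = Dt α L

/-- Two currents are equivalent if they differ by a trivial one. A conservation law is an
equivalence class of conserved currents. -/
def Equivalent (α : ℝ) (J J' : Current) : Prop := IsTrivial α (J - J')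

/-- The expression `∑ₖ (-D_x)ᵏ (∂J₀/∂(∂ₓᵏ u_t))` that computes the characteristic. -/
def characteristic (J : Current) : JetSpace → ℝ := fun p =>
  ∑ᶠ k : ℕ, (-1 : ℝ) ^ k * (Dx^[k] (pd (Coord.ut k) J.1)) p

/-- `χ` is the characteristic of the conservation law represented by the conserved current `J`:
it is the characteristic of every conserved current equivalent to `J`. -/
def IsCharacteristicOf (α : ℝ) (J : Current) (χ : JetSpace → ℝ) : Prop :=
  ∀ J' : Current, IsConserved α J' → Equivalent α J' J → characteristic J' = χ

/-- The current `(u_t t^α, u_xx t^α - (u_x² / 2) t^α)`. -/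
def currentA (α : ℝ) : Current :=
  (fun p => coord (Coord.ut 0) p * coord Coord.t p ^ α,
   fun p => coord (Coord.u 2) p * coord Coord.t p ^ α
      - coord (Coord.u 1) p ^ 2 / 2 * coord Coord.t p ^ α)

/-- The current `(u_t t + (α - 1) u, u_xx t - (u_x² / 2) t)`. -/
def currentB (α : ℝ) : Current :=
  (fun p => coord (Coord.ut 0) p * coord Coord.t p + (α - 1) * coord (Coord.u 0) p,
   fun p => coord (Coord.u 2) p * coord Coord.t p
      - coord (Coord.u 1) p ^ 2 / 2 * coord Coord.t p)

end ViscousTransonic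

end

/-! Write `v_k` for the coordinates `ut k` and `E_u`, `E_v` for the two Euler operators `∑ (-D_x)^k
∂/∂u_k` and `∑ (-D_x)^k ∂/∂v_k`, so that the characteristic of a current with density `f` is `χ =
E_v f`. Both operators annihilate total `x`-derivatives (`euler_totalX`); hence `χ` is unchanged
under equivalence, and both annihilate `D_t f` when `f` is a conserved density.

Commuting the Euler operators past `D_t` (`euler_ut_totalT`, `euler_u_totalT`) turns the second fact
into `E_u f = (α/t) χ - D_t χ` and then into the cosymmetry equation `D_t² χ - D_t((α/t) χ) = D_x³ χ
+ D_x(u_1 D_x χ)`. On leading terms `D_t²` acts as `-D_x³`, because `u_tt = -u_xxx + ...`, whereas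
the right side has `+D_x³`. The top coefficient of `χ` therefore equals its own negative, and
descent on the order shows that `χ` depends on `t` and `x` only (`IsCosymmetry.isBasic`). The
coefficient of `u_2` then gives `χ_x = 0`, and the remaining equation `(χ_t - (α/t) χ)_t = 0` has
solution space spanned by `t^α` and `t` when `α ≠ 1`.

Subtracting the matching combination of the two currents leaves a current with `χ = 0`, hence also
`E_u f = 0`. The common kernel of the Euler operators is the image of `D_x` (`exists_eq_totalX`), so
`f` is a total derivative. The flux is then determined up to a function of `t`, which is absorbed
into the potential (`exists_potential`). -/

noncomputable section
namespace ViscousTransonic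

open Set MeasureTheory
open scoped Interval

/-! ### Smooth dependence of integrals on parameters -/

section ParametricIntegral

variable {E F : Type} [NormedAddCommGroup E] [NormedSpace ℝ E] [ProperSpace E]
  [NormedAddCommGroup F] [NormedSpace ℝ F]

/-- Differentiation under the integral over the unit interval. -/
theorem hasFDerivAt_integral_unitInterval {V : Set (ℝ × E)} {U : Set E} (hV : IsOpen V)
    (hU : IsOpen U) (hUV : Icc (0 : ℝ) 1 ×ˢ U ⊆ V) {h : ℝ × E → F} (hh : ContDiffOn ℝ ∞ h V)
    {q : E} (hq : q ∈ U) :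
    HasFDerivAt (fun q => ∫ s in (0 : ℝ)..1, h (s, q))
      (∫ s in (0 : ℝ)..1, (fderiv ℝ h (s, q)).comp (ContinuousLinearMap.inr ℝ ℝ E)) q := by
  obtain ⟨ε, hε, hball⟩ := Metric.nhds_basis_closedBall.mem_iff.1 (hU.mem_nhds hq)
  have hcont : ContinuousOn
      (fun z => (fderiv ℝ h z).comp (ContinuousLinearMap.inr ℝ ℝ E)) V :=
    (hh.continuousOn_fderiv_of_isOpen hV (by simp)).clm_comp continuousOn_const
  have hslice : ∀ x ∈ U, ∀ G : Type, [TopologicalSpace G] → ∀ k : ℝ × E → G, ContinuousOn k V →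
      ContinuousOn (fun s => k (s, x)) (Icc 0 1) := by
    intro x hx G _ k hk
    exact hk.comp (by fun_prop) fun s hs => hUV ⟨hs, hx⟩
  have hK : IsCompact (Icc (0 : ℝ) 1 ×ˢ Metric.closedBall q ε) :=
    isCompact_Icc.prod (isCompact_closedBall q ε)
  obtain ⟨C, hC⟩ := hK.exists_bound_of_continuousOn
    (hcont.mono fun z hz => hUV ⟨hz.1, hball hz.2⟩)
  have hmeas : ∀ x ∈ U, ∀ {G : Type} [NormedAddCommGroup G] (k : ℝ × E → G),
      ContinuousOn k V → AEStronglyMeasurable (fun s => k (s, x))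
        (volume.restrict (Ι (0 : ℝ) 1)) := by
    intro x hx G _ k hk
    refine ((hslice x hx G k hk).mono ?_).aestronglyMeasurable measurableSet_uIoc
    rw [uIoc_of_le zero_le_one]
    exact Ioc_subset_Icc_self
  refine intervalIntegral.hasFDerivAt_integral_of_dominated_of_fderiv_le
    (F' := fun x s => (fderiv ℝ h (s, x)).comp (ContinuousLinearMap.inr ℝ ℝ E))
    (bound := fun _ => C) (Metric.closedBall_mem_nhds q hε) ?_ ?_ ?_ ?_ ?_ ?_
  · filter_upwards [hU.mem_nhds hq] with x hx using hmeas x hx h hh.continuousOn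
  · refine ContinuousOn.intervalIntegrable ?_
    rw [uIcc_of_le zero_le_one]
    exact hslice q hq F h hh.continuousOn
  · exact hmeas q hq _ hcont
  · refine Filter.Eventually.of_forall fun s hs x hx => ?_
    rw [uIoc_of_le zero_le_one] at hs
    exact hC (s, x) ⟨Ioc_subset_Icc_self hs, hx⟩
  · exact intervalIntegrable_const
  · refine Filter.Eventually.of_forall fun s hs x hx => ?_
    rw [uIoc_of_le zero_le_one] at hs
    have hmem : (s, x) ∈ V := hUV ⟨Ioc_subset_Icc_self hs, hball hx⟩
    have hd : DifferentiableAt ℝ h (s, x) :=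
      (hh.differentiableOn (by simp)).differentiableAt (hV.mem_nhds hmem)
    exact hd.hasFDerivAt.comp x (hasFDerivAt_prodMk_right s x)

/-- The derivative is again an integral of the same kind, with values in a space of operators; the
induction therefore has to let the target space vary. -/
theorem contDiffOn_nat_integral_unitInterval {V : Set (ℝ × E)} {U : Set E} (hV : IsOpen V)
    (hU : IsOpen U) (hUV : Icc (0 : ℝ) 1 ×ˢ U ⊆ V) (n : ℕ) {F : Type} [NormedAddCommGroup F]
    [NormedSpace ℝ F] {h : ℝ × E → F} (hh : ContDiffOn ℝ ∞ h V) :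
    ContDiffOn ℝ n (fun q => ∫ s in (0 : ℝ)..1, h (s, q)) U := by
  induction n generalizing F with
  | zero =>
    refine contDiffOn_zero.2 fun q hq => ?_
    exact (hasFDerivAt_integral_unitInterval hV hU hUV hh hq).continuousAt.continuousWithinAt
  | succ n ih =>
    have hd : ∀ q ∈ U, HasFDerivAt _ _ q := fun q hq =>
      hasFDerivAt_integral_unitInterval hV hU hUV hh hq
    push_cast
    refine (contDiffOn_succ_iff_fderiv_of_isOpen hU).2
      ⟨fun q hq => (hd q hq).differentiableAt.differentiableWithinAt, by simp, ?_⟩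
    refine (ih (h := fun z => (fderiv ℝ h z).comp (ContinuousLinearMap.inr ℝ ℝ E)) ?_).congr
      fun q hq => (hd q hq).fderiv
    exact (hh.fderiv_of_isOpen hV (by simp)).clm_comp contDiffOn_const

/-- An integral over the unit interval depends smoothly on a parameter. -/
theorem contDiffOn_integral_unitInterval {V : Set (ℝ × E)} {U : Set E} (hV : IsOpen V)
    (hU : IsOpen U) (hUV : Icc (0 : ℝ) 1 ×ˢ U ⊆ V) {h : ℝ × E → F} (hh : ContDiffOn ℝ ∞ h V) :
    ContDiffOn ℝ ∞ (fun q => ∫ s in (0 : ℝ)..1, h (s, q)) U :=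
  contDiffOn_infty.2 fun n => contDiffOn_nat_integral_unitInterval hV hU hUV n hh

end ParametricIntegral

/-! ### Functions of finitely many coordinates and their partial derivatives -/

section Representation

/-- The coordinates of a point that belong to a finite set. -/
def restr (S : Finset Coord) (p : JetSpace) : S → ℝ := fun c => p.1 c

/-- The range of `restr S`. -/
def dom (S : Finset Coord) : Set (S → ℝ) := {q | ∀ h : Coord.t ∈ S, 0 < q ⟨Coord.t, h⟩}

/-- The function `f` is given by the smooth function `g` of the coordinates in `S`. -/
structure Represents (S : Finset Coord) (g : (S → ℝ) → ℝ) (f : JetSpace → ℝ) : Prop where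
  smooth : ContDiffOn ℝ ∞ g (dom S)
  eq : ∀ p, f p = g (restr S p)

theorem isSmoothFun_iff {f : JetSpace → ℝ} : IsSmoothFun f ↔ ∃ S g, Represents S g f :=
  ⟨fun ⟨S, g, h1, h2⟩ => ⟨S, g, h1, h2⟩, fun ⟨S, g, h1, h2⟩ => ⟨S, g, h1, h2⟩⟩

theorem isOpen_dom (S : Finset Coord) : IsOpen (dom S) := by
  by_cases h : Coord.t ∈ S
  · have : dom S = {q | 0 < q ⟨Coord.t, h⟩} := by ext q; simp [dom, h]
    rw [this]
    exact isOpen_lt continuous_const (continuous_apply _)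
  · have : dom S = univ := by ext q; simp [dom, h]
    rw [this]
    exact isOpen_univ

theorem convex_dom (S : Finset Coord) : Convex ℝ (dom S) := by
  intro q hq q' hq' a b ha hb hab h
  have h1 := hq h
  have h2 := hq' h
  rcases ha.eq_or_lt with rfl | ha
  · obtain rfl : b = 1 := by linarith
    simpa using h2
  · have : 0 ≤ b * q' ⟨Coord.t, h⟩ := by positivity
    have : 0 < a * q ⟨Coord.t, h⟩ := by positivity
    simp only [Pi.add_apply, Pi.smul_apply, smul_eq_mul]
    linarith

theorem restr_mem_dom (S : Finset Coord) (p : JetSpace) : restr S p ∈ dom S := fun _ => p.2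

theorem exists_restr_eq {S : Finset Coord} {q : S → ℝ} (hq : q ∈ dom S) :
    ∃ p, restr S p = q := by
  -- The filler value is positive because it may be used for `t`.
  refine ⟨⟨fun c => if h : c ∈ S then q ⟨c, h⟩ else 1, ?_⟩, ?_⟩
  · by_cases h : Coord.t ∈ S
    · simpa [h] using hq h
    · simp [h]
  · ext c
    simp [restr]

theorem Represents.enlarge {S : Finset Coord} {g : (S → ℝ) → ℝ} {f : JetSpace → ℝ}
    (h : Represents S g f) {T : Finset Coord} (hST : S ⊆ T) :
    Represents T (fun q => g fun c => q ⟨c, hST c.2⟩) f where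
  smooth := by
    refine h.smooth.comp (t := dom S) ?_ ?_
    · exact ContDiff.contDiffOn (by fun_prop)
    · exact fun q hq ht => hq (hST ht)
  eq p := h.eq p

theorem IsSmoothFun.exists_represents {f : JetSpace → ℝ} (hf : IsSmoothFun f) (T : Finset Coord) :
    ∃ S g, T ⊆ S ∧ Represents S g f := by
  obtain ⟨S, g, h⟩ := isSmoothFun_iff.1 hf
  exact ⟨S ∪ T, _, Finset.subset_union_right, h.enlarge Finset.subset_union_left⟩

/-- Replace the coordinate `c` by `s`. -/
def move (c : Coord) (p : JetSpace) (s : ℝ) (hs : c = Coord.t → 0 < s) : JetSpace :=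
  ⟨Function.update p.1 c s, by
    by_cases h : c = Coord.t
    · subst h
      simpa using hs rfl
    · rw [Function.update_of_ne (Ne.symm h)]
      exact p.2⟩

/-- The restriction of `f` to the coordinate line through `p` in direction `c`. -/
def slice (c : Coord) (f : JetSpace → ℝ) (p : JetSpace) (s : ℝ) : ℝ :=
  Function.extend Subtype.val f 0 (Function.update p.1 c s)

theorem pd_eq (c : Coord) (f : JetSpace → ℝ) (p : JetSpace) :
    pd c f p = deriv (slice c f p) (p.1 c) := rfl

theorem slice_eq {c : Coord} {f : JetSpace → ℝ} {p : JetSpace} {s : ℝ}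
    (hs : c = Coord.t → 0 < s) : slice c f p s = f (move c p s hs) :=
  Subtype.val_injective.extend_apply f 0 (move c p s hs)

theorem move_self (c : Coord) (p : JetSpace) (h : c = Coord.t → 0 < p.1 c) :
    move c p (p.1 c) h = p := Subtype.ext (Function.update_eq_self _ _)

theorem slice_self (c : Coord) (f : JetSpace → ℝ) (p : JetSpace) : slice c f p (p.1 c) = f p := by
  have h : c = Coord.t → 0 < p.1 c := by rintro rfl; exact p.2
  rw [slice_eq h, move_self]

theorem eventually_admissible (c : Coord) (p : JetSpace) :
    ∀ᶠ s in nhds (p.1 c), c = Coord.t → 0 < s := by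
  by_cases h : c = Coord.t
  · subst h
    filter_upwards [lt_mem_nhds p.2] with s hs _ using hs
  · exact Filter.Eventually.of_forall fun s h' => absurd h' h

theorem restr_move_of_mem {S : Finset Coord} {c : Coord} (hc : c ∈ S) (p : JetSpace) (s : ℝ)
    (hs : c = Coord.t → 0 < s) :
    restr S (move c p s hs) = Function.update (restr S p) ⟨c, hc⟩ s := by
  ext d
  by_cases h : d = ⟨c, hc⟩
  · subst h
    simp [restr, move]
  · rw [Function.update_of_ne h]
    have : (d : Coord) ≠ c := fun h' => h (Subtype.ext h')
    simp [restr, move, this]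

theorem restr_move_of_notMem {S : Finset Coord} {c : Coord} (hc : c ∉ S) (p : JetSpace) (s : ℝ)
    (hs : c = Coord.t → 0 < s) : restr S (move c p s hs) = restr S p := by
  ext d
  have : (d : Coord) ≠ c := fun h' => hc (h' ▸ d.2)
  simp [restr, move, this]

variable {S : Finset Coord} {g : (S → ℝ) → ℝ} {f : JetSpace → ℝ}

theorem Represents.differentiableAt (h : Represents S g f) (p : JetSpace) :
    DifferentiableAt ℝ g (restr S p) :=
  (h.smooth.differentiableOn (by simp)).differentiableAt
    ((isOpen_dom S).mem_nhds (restr_mem_dom S p))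

theorem Represents.hasDerivAt_slice (h : Represents S g f) {c : Coord} (hc : c ∈ S)
    (p : JetSpace) :
    HasDerivAt (slice c f p) (fderiv ℝ g (restr S p) (Pi.single ⟨c, hc⟩ 1)) (p.1 c) := by
  have h1 : HasDerivAt (fun s => g (Function.update (restr S p) ⟨c, hc⟩ s))
      (fderiv ℝ g (restr S p) (Pi.single ⟨c, hc⟩ 1)) (p.1 c) := by
    have h2 := hasDerivAt_update (restr S p) ⟨c, hc⟩ (p.1 c)
    refine HasFDerivAt.comp_hasDerivAt (p.1 c) ?_ h2
    have h3 : Function.update (restr S p) ⟨c, hc⟩ (p.1 c) = restr S p :=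
      Function.update_eq_self (⟨c, hc⟩ : S) (restr S p)
    rw [h3]
    exact (h.differentiableAt p).hasFDerivAt
  refine h1.congr_of_eventuallyEq ?_
  filter_upwards [eventually_admissible c p] with s hs
  rw [slice_eq hs, h.eq, restr_move_of_mem hc]

theorem Represents.hasDerivAt_slice_of_notMem (h : Represents S g f) {c : Coord} (hc : c ∉ S)
    (p : JetSpace) : HasDerivAt (slice c f p) 0 (p.1 c) := by
  refine (hasDerivAt_const (p.1 c) (f p)).congr_of_eventuallyEq ?_
  filter_upwards [eventually_admissible c p] with s hs
  rw [slice_eq hs, h.eq, restr_move_of_notMem hc, h.eq]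

theorem Represents.pd_of_mem (h : Represents S g f) {c : Coord} (hc : c ∈ S) :
    Represents S (fun q => fderiv ℝ g q (Pi.single ⟨c, hc⟩ 1)) (pd c f) where
  smooth := (h.smooth.fderiv_of_isOpen (isOpen_dom S) (by simp)).clm_apply contDiffOn_const
  eq p := (h.hasDerivAt_slice hc p).deriv

theorem Represents.pd_of_notMem (h : Represents S g f) {c : Coord} (hc : c ∉ S) : pd c f = 0 :=
  funext fun p => (h.hasDerivAt_slice_of_notMem hc p).deriv

theorem IsSmoothFun.hasDerivAt_slice (hf : IsSmoothFun f) (c : Coord) (p : JetSpace) :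
    HasDerivAt (slice c f p) (pd c f p) (p.1 c) := by
  obtain ⟨S, g, hS, h⟩ := hf.exists_represents {c}
  have hc : c ∈ S := hS (Finset.mem_singleton_self c)
  rw [(h.pd_of_mem hc).eq]
  exact h.hasDerivAt_slice hc p

theorem IsSmoothFun.pd (hf : IsSmoothFun f) (c : Coord) : IsSmoothFun (pd c f) := by
  obtain ⟨S, g, hS, h⟩ := hf.exists_represents {c}
  exact isSmoothFun_iff.2 ⟨S, _, h.pd_of_mem (hS (Finset.mem_singleton_self c))⟩

theorem IsSmoothFun.pd_comm (hf : IsSmoothFun f) (c d : Coord) :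
    ViscousTransonic.pd c (ViscousTransonic.pd d f) =
      ViscousTransonic.pd d (ViscousTransonic.pd c f) := by
  obtain ⟨S, g, hS, h⟩ := hf.exists_represents {c, d}
  have hc : c ∈ S := hS (by simp)
  have hd : d ∈ S := hS (by simp)
  funext p
  rw [((h.pd_of_mem hc).pd_of_mem hd).eq, ((h.pd_of_mem hd).pd_of_mem hc).eq]
  have hat : ContDiffAt ℝ ∞ g (restr S p) :=
    h.smooth.contDiffAt ((isOpen_dom S).mem_nhds (restr_mem_dom S p))
  have hdiff : DifferentiableAt ℝ (fderiv ℝ g) (restr S p) :=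
    (hat.fderiv_right (m := 1) (by norm_cast)).differentiableAt (by simp)
  have hsymm : IsSymmSndFDerivAt ℝ g (restr S p) := 
    hat.isSymmSndFDerivAt (by simpa using WithTop.coe_le_coe.2 (le_top : (2 : ℕ∞) ≤ ⊤))
  rw [fderiv_clm_apply hdiff (by fun_prop), fderiv_clm_apply hdiff (by fun_prop)]
  simpa using hsymm _ _

/-- A smooth function that has zero derivative in the direction `c` does not depend on `c`. -/
theorem IsSmoothFun.eq_move (hf : IsSmoothFun f) {c : Coord} (h0 : ViscousTransonic.pd c f = 0)
    (p : JetSpace) (s : ℝ) (hs : c = Coord.t → 0 < s) : f (move c p s hs) = f p := by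
  have hpc : c = Coord.t → 0 < p.1 c := by rintro rfl; exact p.2
  -- The admissible values form a half-line for `t` and the whole line otherwise. Both are open and
  -- connected, so a vanishing derivative forces constancy.
  let I : Set ℝ := {s | c = Coord.t → 0 < s}
  have hI : IsOpen I ∧ IsPreconnected I := by
    by_cases h : c = Coord.t
    · have : I = Ioi 0 := by ext; simp [I, h]
      rw [this]
      exact ⟨isOpen_Ioi, isPreconnected_Ioi⟩
    · have : I = univ := by ext; simp [I, h]
      rw [this]
      exact ⟨isOpen_univ, isPreconnected_univ⟩
  have hder : ∀ r ∈ I, HasDerivAt (slice c f p) 0 r := by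
    intro r hr
    have h1 := hf.hasDerivAt_slice c (move c p r hr)
    rw [h0] at h1
    have h2 : slice c f (move c p r hr) = slice c f p := by
      funext z
      simp [slice, move]
    have h3 : (move c p r hr).1 c = r := by simp [move]
    rw [h2, h3] at h1
    exact h1
  have := hI.1.is_const_of_deriv_eq_zero hI.2
    (fun r hr => (hder r hr).differentiableAt.differentiableWithinAt)
    (fun r hr => (hder r hr).deriv) (x := s) (y := p.1 c) hs hpc
  rwa [slice_eq hs, slice_self] at this

/-- A smooth function all of whose partial derivatives vanish is constant. -/
theorem IsSmoothFun.eq_const (hf : IsSmoothFun f) (h0 : ∀ c, ViscousTransonic.pd c f = 0) :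
    ∃ a : ℝ, ∀ p, f p = a := by
  obtain ⟨S, g, h⟩ := isSmoothFun_iff.1 hf
  refine ⟨g fun _ => 1, fun p => ?_⟩
  rw [h.eq]
  refine (isOpen_dom S).is_const_of_fderiv_eq_zero (convex_dom S).isPreconnected
    (h.smooth.differentiableOn (by simp)) ?_ (restr_mem_dom S p) (fun _ => zero_lt_one)
  intro q hq
  obtain ⟨p, rfl⟩ := exists_restr_eq hq
  refine ContinuousLinearMap.coe_injective (LinearMap.pi_ext' fun c => LinearMap.ext_ring ?_)
  have := (h.pd_of_mem c.2).eq p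
  rw [h0] at this
  simpa using this.symm

/-- Smooth functions have smooth primitives with respect to each coordinate. -/
theorem IsSmoothFun.exists_primitive (hf : IsSmoothFun f) (c : Coord) :
    ∃ F, IsSmoothFun F ∧ ViscousTransonic.pd c F = f ∧
      ∀ d, d ≠ c → ViscousTransonic.pd d f = 0 → ViscousTransonic.pd d F = 0 := by
  obtain ⟨S, g, hS, h⟩ := hf.exists_represents {c}
  have hc : c ∈ S := hS (Finset.mem_singleton_self c)
  let c' : S := ⟨c, hc⟩
  -- The integral of `g` from 1 to `q c'`, rescaled to the unit interval so that the parameter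
  -- leaves the endpoints. The base point 1 is admissible for `t` as well.
  let G : (S → ℝ) → ℝ := fun q =>
    (q c' - 1) * ∫ s in (0 : ℝ)..1, g (Function.update q c' (1 + s * (q c' - 1)))
  let F : JetSpace → ℝ := fun p => ∫ s in (1 : ℝ)..p.1 c, slice c f p s
  have hpos : ∀ p : JetSpace, ∀ s ∈ Ι 1 (p.1 c), c = Coord.t → 0 < s := by
    rintro p s hs rfl
    rw [uIoc, mem_Ioc] at hs
    exact (lt_min zero_lt_one p.2).trans hs.1
  have hGF : ∀ p, F p = G (restr S p) := by
    intro p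
    have h1 : F p = ∫ s in (1 : ℝ)..p.1 c, g (Function.update (restr S p) c' s) := by
      refine intervalIntegral.integral_congr_ae (Filter.Eventually.of_forall fun s hs => ?_)
      rw [slice_eq (hpos p s hs), h.eq, restr_move_of_mem hc]
    rw [h1]
    have h2 := intervalIntegral.smul_integral_comp_add_mul
      (fun s => g (Function.update (restr S p) c' s)) (a := 0) (b := 1) (p.1 c - 1) 1
    simp only [mul_zero, add_zero, mul_one, add_sub_cancel, smul_eq_mul] at h2
    rw [← h2]
    simp only [G, mul_comm _ (restr S p c' - 1)]
    rfl
  have hG : Represents S G F := by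
    refine ⟨?_, hGF⟩
    refine ContDiffOn.mul (ContDiff.contDiffOn (by fun_prop)) ?_
    let φ : ℝ × (S → ℝ) → S → ℝ := fun z =>
      Function.update z.2 c' (1 + z.1 * (z.2 c' - 1))
    have hφ : ContDiff ℝ ∞ φ := by
      refine contDiff_pi.2 fun d => ?_
      by_cases hd : d = c'
      · subst hd
        simp only [φ, Function.update_self]
        fun_prop
      · simp only [φ, Function.update_of_ne hd]
        fun_prop
    refine contDiffOn_integral_unitInterval (V := φ ⁻¹' dom S)
      ((isOpen_dom S).preimage hφ.continuous) (isOpen_dom S) ?_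
      (h := fun z => g (φ z)) (h.smooth.comp hφ.contDiffOn fun z hz => hz)
    rintro ⟨s, q⟩ ⟨hs, hq⟩ ht
    have h1 := hq ht
    -- If `t` is the variable of integration, then `1 + s(t - 1) = (1 - s) + s t` stays positive for
    -- `s` in the unit interval.
    by_cases hd : (⟨Coord.t, ht⟩ : S) = c'
    · simp only [φ, hd, Function.update_self]
      rw [hd] at h1
      rcases hs.1.eq_or_lt with h0 | h0
      · simp only at h0
        rw [← h0]
        norm_num
      · have : 0 < s * q c' := mul_pos h0 h1
        have := hs.2
        simp only at this
        nlinarith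
    · simpa only [φ, Function.update_of_ne hd] using h1
  refine ⟨F, isSmoothFun_iff.2 ⟨S, G, hG⟩, ?_, ?_⟩
  · funext p
    have hpc : c = Coord.t → 0 < p.1 c := by rintro rfl; exact p.2
    have hcont : ∀ r, (c = Coord.t → 0 < r) → ContinuousAt (slice c f p) r := by
      intro r hr
      have h1 := (hf.hasDerivAt_slice c (move c p r hr)).continuousAt
      have h2 : slice c f (move c p r hr) = slice c f p := by
        funext z
        simp [slice, move]
      have h3 : (move c p r hr).1 c = r := by simp [move]
      rwa [h2, h3] at h1
    have hadm : ∀ r ∈ uIcc 1 (p.1 c), c = Coord.t → 0 < r := by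
      rintro r hr rfl
      exact (lt_min zero_lt_one p.2).trans_le hr.1
    have h4 : HasDerivAt (fun r => ∫ s in (1 : ℝ)..r, slice c f p s) (slice c f p (p.1 c))
        (p.1 c) := by
      refine intervalIntegral.integral_hasDerivAt_right
        (ContinuousOn.intervalIntegrable fun r hr => (hcont r (hadm r hr)).continuousWithinAt)
        ?_ (hcont _ hpc)
      refine ContinuousAt.stronglyMeasurableAtFilter (s := {r | c = Coord.t → 0 < r}) ?_
        (fun r hr => hcont r hr) _ hpc
      by_cases hct : c = Coord.t
      · simpa [hct] using isOpen_lt continuous_const continuous_id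
      · simp [hct]
    rw [pd_eq, ← slice_self c f p]
    refine (h4.congr_of_eventuallyEq ?_).deriv
    filter_upwards [eventually_admissible c p] with r hr
    rw [slice_eq hr]
    simp only [F]
    have h3 : (move c p r hr).1 c = r := by simp [move]
    rw [h3]
    refine intervalIntegral.integral_congr fun z _ => ?_
    simp [slice, move]
  · intro d hd h0
    funext p
    rw [pd_eq]
    refine ((hasDerivAt_const (p.1 d) (F p)).congr_of_eventuallyEq ?_).deriv
    filter_upwards [eventually_admissible d p] with r hr
    rw [slice_eq hr]
    have h3 : (move d p r hr).1 c = p.1 c := by simp [move, Function.update_of_ne hd.symm]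
    simp only [F]
    rw [h3]
    refine intervalIntegral.integral_congr_ae (Filter.Eventually.of_forall fun s hs => ?_)
    have hs' := hpos p s hs
    rw [slice_eq hs', slice_eq hs', ← hf.eq_move h0 (move c p s hs') r hr]
    congr 1
    exact Subtype.ext (Function.update_comm hd.symm _ _ _).symm

end Representation

end ViscousTransonic
end

noncomputable section
namespace ViscousTransonic

/-! ### The algebra of smooth functions and its coordinate derivations -/

section Algebra

theorem isSmoothFun_of_forall_contDiffOn {f : JetSpace → ℝ} {S : Finset Coord}
    {g : (S → ℝ) → ℝ} (hg : ContDiffOn ℝ ∞ g (dom S)) (h : ∀ p, f p = g (restr S p)) :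
    IsSmoothFun f := ⟨S, g, hg, h⟩

theorem isSmoothFun_const (a : ℝ) : IsSmoothFun fun _ => a :=
  isSmoothFun_of_forall_contDiffOn (S := ∅) (g := fun _ => a) contDiffOn_const fun _ => rfl

theorem IsSmoothFun.common_represents {f₁ f₂ : JetSpace → ℝ} (h₁ : IsSmoothFun f₁)
    (h₂ : IsSmoothFun f₂) : ∃ S g₁ g₂, Represents S g₁ f₁ ∧ Represents S g₂ f₂ := by
  obtain ⟨S, g, h⟩ := isSmoothFun_iff.1 h₁
  obtain ⟨T, g', hT, h'⟩ := h₂.exists_represents S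
  exact ⟨T, _, _, h.enlarge hT, h'⟩

/-- The algebra of smooth functions of finitely many coordinates. -/
def smoothAlgebra : Subalgebra ℝ (JetSpace → ℝ) where
  carrier := {f | IsSmoothFun f}
  mul_mem' := by
    rintro f₁ f₂ h₁ h₂
    obtain ⟨S, g₁, g₂, h₁, h₂⟩ := IsSmoothFun.common_represents h₁ h₂
    exact isSmoothFun_of_forall_contDiffOn (h₁.smooth.mul h₂.smooth) fun p => by
      simp [h₁.eq, h₂.eq]
  add_mem' := by
    rintro f₁ f₂ h₁ h₂
    obtain ⟨S, g₁, g₂, h₁, h₂⟩ := IsSmoothFun.common_represents h₁ h₂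
    exact isSmoothFun_of_forall_contDiffOn (h₁.smooth.add h₂.smooth) fun p => by
      simp [h₁.eq, h₂.eq]
  algebraMap_mem' a := isSmoothFun_const a

/-- Smooth functions of finitely many coordinates. -/
abbrev SmoothFun : Type := smoothAlgebra

theorem hasDerivAt_slice_coe (f : SmoothFun) (c : Coord) (p : JetSpace) :
    HasDerivAt (slice c f.1 p) (pd c f.1 p) (p.1 c) :=
  IsSmoothFun.hasDerivAt_slice f.2 c p

theorem pd_eq_of_hasDerivAt {c : Coord} {f : JetSpace → ℝ} {p : JetSpace} {φ : ℝ → ℝ} {a : ℝ}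
    (hφ : HasDerivAt φ a (p.1 c)) (h : ∀ s hs, f (move c p s hs) = φ s) : pd c f p = a := by
  rw [pd_eq]
  refine (hφ.congr_of_eventuallyEq ?_).deriv
  filter_upwards [eventually_admissible c p] with s hs
  rw [slice_eq hs, h]

theorem slice_add (c : Coord) (f g : JetSpace → ℝ) (p : JetSpace) :
    slice c (f + g) p = slice c f p + slice c g p := by
  funext s
  have := congrFun (Function.extend_add (Subtype.val : JetSpace → Coord → ℝ) f g 0 0)
    (Function.update p.1 c s)
  simpa [slice] using this

theorem slice_mul (c : Coord) (f g : JetSpace → ℝ) (p : JetSpace) :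
    slice c (f * g) p = slice c f p * slice c g p := by
  funext s
  have := congrFun (Function.extend_mul (Subtype.val : JetSpace → Coord → ℝ) f g 0 0)
    (Function.update p.1 c s)
  simpa [slice] using this

/-- The partial derivative with respect to a coordinate. -/
def par (c : Coord) : Derivation ℝ SmoothFun SmoothFun :=
  Derivation.mk'
    { toFun := fun f => ⟨pd c f.1, IsSmoothFun.pd f.2 c⟩
      map_add' := fun f g => Subtype.ext <| funext fun p => by
        have := (hasDerivAt_slice_coe f c p).add (hasDerivAt_slice_coe g c p)
        rw [← slice_add] at this
        exact this.deriv
      map_smul' := fun a f => Subtype.ext <| funext fun p => by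
        refine pd_eq_of_hasDerivAt (φ := fun s => a * slice c f.1 p s)
          ((hasDerivAt_slice_coe f c p).const_mul a) fun s hs => ?_
        rw [slice_eq hs]
        rfl }
    (fun f g => Subtype.ext <| funext fun p => by
      have := (hasDerivAt_slice_coe f c p).mul (hasDerivAt_slice_coe g c p)
      rw [← slice_mul, slice_self, slice_self] at this
      refine this.deriv.trans ?_
      simp only [LinearMap.coe_mk, AddHom.coe_mk, smul_eq_mul, MulMemClass.coe_mul,
        Pi.add_apply, Pi.mul_apply, AddMemClass.coe_add]
      ring)

theorem coe_par (c : Coord) (f : SmoothFun) : (par c f).1 = pd c f.1 := rfl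

theorem par_comm (c d : Coord) (f : SmoothFun) : par c (par d f) = par d (par c f) :=
  Subtype.ext (IsSmoothFun.pd_comm f.2 c d)

theorem exists_primitive (f : SmoothFun) (c : Coord) :
    ∃ F, par c F = f ∧ ∀ d, d ≠ c → par d f = 0 → par d F = 0 := by
  obtain ⟨F, hF, h1, h2⟩ := IsSmoothFun.exists_primitive f.2 c
  exact ⟨⟨F, hF⟩, Subtype.ext h1, fun d hd h0 => Subtype.ext (h2 d hd (congrArg Subtype.val h0))⟩

theorem exists_eq_algebraMap {f : SmoothFun} (h : ∀ c, par c f = 0) :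
    ∃ a : ℝ, f = algebraMap ℝ SmoothFun a := by
  obtain ⟨a, ha⟩ := IsSmoothFun.eq_const f.2 fun c => congrArg Subtype.val (h c)
  exact ⟨a, Subtype.ext (funext ha)⟩

theorem finite_par_ne_zero (f : SmoothFun) : {c | par c f ≠ 0}.Finite := by
  obtain ⟨S, g, h⟩ := isSmoothFun_iff.1 f.2
  refine S.finite_toSet.subset fun c hc => ?_
  by_contra hcS
  exact hc (Subtype.ext (h.pd_of_notMem hcS))

/-- Finite dependence on coordinates: this is what truncates every formally infinite sum below. -/
theorem exists_par_eq_zero {w : ℕ → Coord} (hw : Function.Injective w) (f : SmoothFun) :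
    ∃ N, ∀ k, N ≤ k → par (w k) f = 0 := by
  obtain ⟨M, hM⟩ := ((finite_par_ne_zero f).preimage hw.injOn).bddAbove
  refine ⟨M + 1, fun k hk => ?_⟩
  by_contra h
  have := hM h
  omega

/-- A coordinate as an element of the algebra. -/
def X (c : Coord) : SmoothFun := ⟨coord c,
  isSmoothFun_of_forall_contDiffOn (S := {c}) (g := fun q => q ⟨c, Finset.mem_singleton_self c⟩)
    (ContDiff.contDiffOn (by fun_prop)) fun _ => rfl⟩

/-- A real power of `t`. -/
def tpow (a : ℝ) : SmoothFun := ⟨fun p => coord Coord.t p ^ a,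
  isSmoothFun_of_forall_contDiffOn (S := {Coord.t})
    (g := fun q => q ⟨Coord.t, Finset.mem_singleton_self _⟩ ^ a)
    (ContDiffOn.rpow_const_of_ne (ContDiff.contDiffOn (by fun_prop))
      fun q hq => (hq (Finset.mem_singleton_self _)).ne') fun _ => rfl⟩

theorem par_X_self (c : Coord) : par c (X c) = 1 :=
  Subtype.ext <| funext fun p => pd_eq_of_hasDerivAt (hasDerivAt_id (p.1 c)) fun s hs => by
    simp [X, coord, move]

theorem par_X_of_ne {c d : Coord} (h : c ≠ d) : par c (X d) = 0 :=
  Subtype.ext <| funext fun p => pd_eq_of_hasDerivAt (hasDerivAt_const (p.1 c) (p.1 d))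
    fun s hs => by simp [X, coord, move, Function.update_of_ne h.symm]

theorem par_X (c d : Coord) : par c (X d) = if c = d then 1 else 0 := by
  split_ifs with h
  · rw [h, par_X_self]
  · exact par_X_of_ne h

theorem par_t_tpow (a : ℝ) : par Coord.t (tpow a) = a • tpow (a - 1) :=
  Subtype.ext <| funext fun p => pd_eq_of_hasDerivAt
    (Real.hasDerivAt_rpow_const (Or.inl (ne_of_gt p.2))) fun s hs => by
      simp [tpow, coord, move]

theorem par_tpow_of_ne {c : Coord} (h : c ≠ Coord.t) (a : ℝ) : par c (tpow a) = 0 :=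
  Subtype.ext <| funext fun p => pd_eq_of_hasDerivAt (hasDerivAt_const (p.1 c) (p.1 Coord.t ^ a))
    fun s hs => by simp [tpow, coord, move, Function.update_of_ne h.symm]

theorem tpow_mul (a b : ℝ) : tpow a * tpow b = tpow (a + b) :=
  Subtype.ext <| funext fun p => (Real.rpow_add p.2 a b).symm

theorem tpow_zero : tpow 0 = 1 := Subtype.ext <| funext fun _ => Real.rpow_zero _

theorem tpow_one : tpow 1 = X Coord.t := Subtype.ext <| funext fun _ => Real.rpow_one _

end Algebra

/-! ### Vector fields on jet space and total derivatives -/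

section VectorFields

variable {w : ℕ → Coord} (hw : Function.Injective w)

theorem finsum_eq_sum_range {M : Type*} [AddCommMonoid M] {h : ℕ → M} {N : ℕ}
    (hN : ∀ k, N ≤ k → h k = 0) : ∑ᶠ k, h k = ∑ k ∈ Finset.range N, h k :=
  finsum_eq_sum_of_support_subset _ fun k hk => by
    by_contra h'
    exact hk (hN k (by simpa using h'))

theorem field_eq_sum (G : ℕ → SmoothFun) {f : SmoothFun} {N : ℕ}
    (hN : ∀ k, N ≤ k → par (w k) f = 0) :
    ∑ᶠ k, G k * par (w k) f = ∑ k ∈ Finset.range N, G k * par (w k) f :=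
  finsum_eq_sum_range fun k hk => by rw [hN k hk, mul_zero]

theorem exists_par_eq_zero₂ {w : ℕ → Coord} (hw : Function.Injective w) (f g : SmoothFun) :
    ∃ N, (∀ k, N ≤ k → par (w k) f = 0) ∧ ∀ k, N ≤ k → par (w k) g = 0 := by
  obtain ⟨N, hN⟩ := exists_par_eq_zero hw f
  obtain ⟨M, hM⟩ := exists_par_eq_zero hw g
  exact ⟨max N M, fun k hk => hN k (le_of_max_le_left hk), fun k hk => hM k (le_of_max_le_right hk)⟩

/-- The vector field `∑ₖ Gₖ ∂/∂wₖ`. -/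
def field (G : ℕ → SmoothFun) : Derivation ℝ SmoothFun SmoothFun :=
  Derivation.mk'
    { toFun := fun f => ∑ᶠ k, G k * par (w k) f
      map_add' := fun f g => by
        obtain ⟨N, hf, hg⟩ := exists_par_eq_zero₂ hw f g
        rw [field_eq_sum G hf, field_eq_sum G hg, field_eq_sum G (N := N), ← Finset.sum_add_distrib]
        · simp [mul_add]
        · intro k hk
          rw [map_add, hf k hk, hg k hk, add_zero]
      map_smul' := fun a f => by
        obtain ⟨N, hf⟩ := exists_par_eq_zero hw f
        rw [field_eq_sum G hf, field_eq_sum G (N := N), RingHom.id_apply, Finset.smul_sum]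
        · simp
        · intro k hk
          rw [Derivation.map_smul, hf k hk, smul_zero] }
    (fun f g => by
      obtain ⟨N, hf, hg⟩ := exists_par_eq_zero₂ hw f g
      simp only [LinearMap.coe_mk, AddHom.coe_mk]
      rw [field_eq_sum G hf, field_eq_sum G hg, field_eq_sum G (N := N), smul_eq_mul, smul_eq_mul,
        Finset.mul_sum, Finset.mul_sum, ← Finset.sum_add_distrib]
      · refine Finset.sum_congr rfl fun k _ => ?_
        rw [Derivation.leibniz, smul_eq_mul, smul_eq_mul]
        ring
      · intro k hk
        rw [Derivation.leibniz, hf k hk, hg k hk, smul_zero, smul_zero, add_zero])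

theorem field_apply (G : ℕ → SmoothFun) (f : SmoothFun) :
    field hw G f = ∑ᶠ k, G k * par (w k) f := rfl

theorem field_apply_sum (G : ℕ → SmoothFun) {f : SmoothFun} {N : ℕ}
    (hN : ∀ k, N ≤ k → par (w k) f = 0) :
    field hw G f = ∑ k ∈ Finset.range N, G k * par (w k) f := field_eq_sum G hN

theorem coe_sum_apply (s : Finset ℕ) (h : ℕ → SmoothFun) (p : JetSpace) :
    (∑ k ∈ s, h k).1 p = ∑ k ∈ s, (h k).1 p := by
  induction s using Finset.cons_induction with
  | empty => rfl
  | cons a s ha ih => rw [Finset.sum_cons, Finset.sum_cons, ← ih]; rfl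

theorem coe_field (G : ℕ → SmoothFun) (f : SmoothFun) (p : JetSpace) :
    (field hw G f).1 p = ∑ᶠ k, (G k).1 p * pd (w k) f.1 p := by
  obtain ⟨N, hN⟩ := exists_par_eq_zero hw f
  rw [field_apply_sum hw G hN, finsum_eq_sum_range (N := N), coe_sum_apply]
  · rfl
  · intro k hk
    have := congrFun (congrArg Subtype.val (hN k hk)) p
    rw [coe_par] at this
    rw [this]
    exact mul_zero _

theorem field_eq_zero (G : ℕ → SmoothFun) {f : SmoothFun}
    (h : ∀ k, G k = 0 ∨ par (w k) f = 0) : field hw G f = 0 := by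
  rw [field_apply]
  refine (finsum_congr fun k => ?_).trans finsum_zero
  rcases h k with h | h <;> simp [h]

theorem field_eq_single (G : ℕ → SmoothFun) {f : SmoothFun} (j : ℕ)
    (h : ∀ k, k ≠ j → G k = 0 ∨ par (w k) f = 0) : field hw G f = G j * par (w j) f := by
  rw [field_apply]
  refine finsum_eq_single _ j fun k hk => ?_
  rcases h k hk with h | h <;> simp [h]

theorem par_field (c : Coord) (G : ℕ → SmoothFun) (f : SmoothFun) :
    par c (field hw G f) = field hw G (par c f) + field hw (fun k => par c (G k)) f := by
  obtain ⟨N, hN⟩ := exists_par_eq_zero hw f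
  rw [field_apply_sum hw G hN, field_apply_sum hw _ hN, field_apply_sum hw (N := N), map_sum,
    ← Finset.sum_add_distrib]
  · refine Finset.sum_congr rfl fun k _ => ?_
    rw [Derivation.leibniz, smul_eq_mul, smul_eq_mul, par_comm]
    ring
  · intro k hk
    rw [par_comm, hN k hk, map_zero]

theorem field_X (G : ℕ → SmoothFun) (k : ℕ) : field hw G (X (w k)) = G k := by
  rw [field_eq_single hw G k, par_X_self, mul_one]
  intro j hj
  right
  exact par_X_of_ne fun h => hj (hw h)

theorem field_X_of_ne (G : ℕ → SmoothFun) {c : Coord} (hc : ∀ k, w k ≠ c) :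
    field hw G (X c) = 0 := field_eq_zero hw G fun k => Or.inr (par_X_of_ne (hc k))

theorem field_tpow (G : ℕ → SmoothFun) (hc : ∀ k, w k ≠ Coord.t) (a : ℝ) :
    field hw G (tpow a) = 0 := field_eq_zero hw G fun k => Or.inr (par_tpow_of_ne (hc k) a)

theorem u_injective : Function.Injective Coord.u := fun _ _ h => Coord.u.inj h

theorem ut_injective : Function.Injective Coord.ut := fun _ _ h => Coord.ut.inj h

/-- The total derivative with respect to `x` on the algebra of smooth functions. -/
def totalX : Derivation ℝ SmoothFun SmoothFun :=
  par Coord.x + field u_injective (fun k => X (Coord.u (k + 1)))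
    + field ut_injective (fun k => X (Coord.ut (k + 1)))

theorem totalX_apply (f : SmoothFun) : totalX f = par Coord.x f
    + field u_injective (fun k => X (Coord.u (k + 1))) f
    + field ut_injective (fun k => X (Coord.ut (k + 1))) f := rfl

theorem coe_totalX (f : SmoothFun) : (totalX f).1 = Dx f.1 := by
  funext p
  rw [Dx]
  have h1 := coe_field u_injective (fun k => X (Coord.u (k + 1))) f p
  have h2 := coe_field ut_injective (fun k => X (Coord.ut (k + 1))) f p
  exact congrArg₂ _ (congrArg₂ _ rfl h1) h2

/-- The coefficient `α / t`. -/
def damping (α : ℝ) : SmoothFun := α • tpow (-1)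

/-- The right-hand side of the equation. -/
def rhsFun (α : ℝ) : SmoothFun :=
  -X (Coord.u 3) + X (Coord.u 1) * X (Coord.u 2) - damping α * X (Coord.ut 0)

theorem coe_rhsFun (α : ℝ) : (rhsFun α).1 = rhs α := by
  funext p
  have : (damping α).1 p = α / coord Coord.t p := by
    rw [div_eq_mul_inv, ← Real.rpow_neg_one]
    rfl
  rw [rhs, ← this]
  rfl

theorem coe_iterate_totalX (k : ℕ) (f : SmoothFun) : (totalX^[k] f).1 = Dx^[k] f.1 := by
  induction k with
  | zero => rfl
  | succ k ih => rw [Function.iterate_succ_apply', Function.iterate_succ_apply', coe_totalX, ih]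

/-- The total derivative with respect to `t` on the algebra of smooth functions. -/
def totalT (α : ℝ) : Derivation ℝ SmoothFun SmoothFun :=
  par Coord.t + field u_injective (fun k => X (Coord.ut k))
    + field ut_injective (fun k => totalX^[k] (rhsFun α))

theorem totalT_apply (α : ℝ) (f : SmoothFun) : totalT α f = par Coord.t f
    + field u_injective (fun k => X (Coord.ut k)) f
    + field ut_injective (fun k => totalX^[k] (rhsFun α)) f := rfl

theorem coe_totalT (α : ℝ) (f : SmoothFun) : (totalT α f).1 = Dt α f.1 := by
  funext p
  rw [Dt]
  have h1 := coe_field u_injective (fun k => X (Coord.ut k)) f p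
  have h2 := coe_field ut_injective (fun k => totalX^[k] (rhsFun α)) f p
  simp only [coe_iterate_totalX, coe_rhsFun] at h2
  exact congrArg₂ _ (congrArg₂ _ rfl h1) h2

end VectorFields

/-! ### Commutation of partial and total derivatives -/

section Commutators

theorem par_totalX (c : Coord) (f : SmoothFun) : par c (totalX f) = totalX (par c f)
    + field u_injective (fun k => par c (X (Coord.u (k + 1)))) f
    + field ut_injective (fun k => par c (X (Coord.ut (k + 1)))) f := by
  simp only [totalX_apply, map_add, par_field, par_comm c Coord.x]
  abel

theorem par_totalX_of_forall_ne {c : Coord} (h1 : ∀ k, c ≠ Coord.u (k + 1))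
    (h2 : ∀ k, c ≠ Coord.ut (k + 1)) (f : SmoothFun) :
    par c (totalX f) = totalX (par c f) := by
  rw [par_totalX, field_eq_zero, field_eq_zero, add_zero, add_zero]
  · exact fun k => Or.inl (par_X_of_ne (h2 k))
  · exact fun k => Or.inl (par_X_of_ne (h1 k))

/-- The coordinates `w 0, w 1, …` form the sequence of `x`-derivatives of one variable. -/
structure IsDerivativeTower (w : ℕ → Coord) : Prop where
  injective : Function.Injective w
  zero : ∀ f, par (w 0) (totalX f) = totalX (par (w 0) f)
  succ : ∀ k f, par (w (k + 1)) (totalX f) = totalX (par (w (k + 1)) f) + par (w k) f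

theorem isDerivativeTower_u : IsDerivativeTower Coord.u where
  injective := u_injective
  zero := par_totalX_of_forall_ne (by simp) (by simp)
  succ k f := by
    rw [par_totalX, field_eq_single u_injective _ k, field_eq_zero, par_X_self, one_mul, add_zero]
    · exact fun j => Or.inl (par_X_of_ne (by simp))
    · exact fun j hj => Or.inl (par_X_of_ne (by simpa using hj.symm))

theorem isDerivativeTower_ut : IsDerivativeTower Coord.ut where
  injective := ut_injective
  zero := par_totalX_of_forall_ne (by simp) (by simp)
  succ k f := by
    rw [par_totalX, field_eq_single ut_injective _ k, field_eq_zero, par_X_self, one_mul, add_zero]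
    · exact fun j => Or.inl (par_X_of_ne (by simp))
    · exact fun j hj => Or.inl (par_X_of_ne (by simpa using hj.symm))

theorem par_t_totalX (f : SmoothFun) : par Coord.t (totalX f) = totalX (par Coord.t f) :=
  par_totalX_of_forall_ne (by simp) (by simp) f

theorem par_totalT (α : ℝ) (c : Coord) (f : SmoothFun) : par c (totalT α f) = totalT α (par c f)
    + field u_injective (fun k => par c (X (Coord.ut k))) f
    + field ut_injective (fun k => par c (totalX^[k] (rhsFun α))) f := by
  simp only [totalT_apply, map_add, par_field, par_comm c Coord.t]
  abel

theorem totalX_X_u (k : ℕ) : totalX (X (Coord.u k)) = X (Coord.u (k + 1)) := by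
  rw [totalX_apply, field_X, field_X_of_ne, par_X_of_ne] <;> simp

theorem totalX_X_ut (k : ℕ) : totalX (X (Coord.ut k)) = X (Coord.ut (k + 1)) := by
  rw [totalX_apply, field_X, field_X_of_ne, par_X_of_ne] <;> simp

theorem totalX_tpow (a : ℝ) : totalX (tpow a) = 0 := by
  rw [totalX_apply, field_tpow, field_tpow, par_tpow_of_ne] <;> simp

theorem totalX_damping (α : ℝ) : totalX (damping α) = 0 := by
  rw [damping, Derivation.map_smul, totalX_tpow, smul_zero]

theorem totalT_X_u (α : ℝ) (k : ℕ) : totalT α (X (Coord.u k)) = X (Coord.ut k) := by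
  rw [totalT_apply, field_X, field_X_of_ne, par_X_of_ne] <;> simp

theorem totalT_X_ut (α : ℝ) (k : ℕ) :
    totalT α (X (Coord.ut k)) = totalX^[k] (rhsFun α) := by
  rw [totalT_apply, field_X, field_X_of_ne, par_X_of_ne] <;> simp

theorem totalT_tpow (α a : ℝ) : totalT α (tpow a) = a • tpow (a - 1) := by
  rw [totalT_apply, field_tpow, field_tpow, par_t_tpow] <;> simp

/-- The commutator of `D_x` with `∑ G_k ∂/∂w_k` has coefficients `D_x G_k - G_{k+1}`. They vanish
for the two vertical parts of `D_t`, whence `D_x` and `D_t` commute. -/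
theorem totalX_field (w : ℕ → Coord) (hw : IsDerivativeTower w) (G : ℕ → SmoothFun)
    (f : SmoothFun) : totalX (field hw.injective G f) + field hw.injective (fun k => G (k + 1)) f =
      field hw.injective G (totalX f) + field hw.injective (fun k => totalX (G k)) f := by
  obtain ⟨N, hN, -⟩ := exists_par_eq_zero₂ hw.injective f 0
  have h1 : ∀ k, N + 1 ≤ k → par (w k) f = 0 := fun k hk => hN k (by omega)
  have h2 : ∀ k, N + 1 ≤ k → par (w k) (totalX f) = 0 := by
    rintro (_ | k) hk
    · omega
    · rw [hw.succ, hN k (by omega), hN _ (by omega), map_zero, add_zero]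
  rw [field_apply_sum _ G hN, field_apply_sum _ (fun k => G (k + 1)) hN,
    field_apply_sum _ _ h2, field_apply_sum _ (fun k => totalX (G k)) hN, Finset.sum_range_succ',
    hw.zero]
  have h3 : ∑ k ∈ Finset.range N, totalX (G k * par (w k) f) =
      (∑ k ∈ Finset.range N, G (k + 1) * totalX (par (w (k + 1)) f) + G 0 * totalX (par (w 0) f))
        + ∑ k ∈ Finset.range N, totalX (G k) * par (w k) f := by
    rw [← Finset.sum_range_succ' (fun k => G k * totalX (par (w k) f)), Finset.sum_range_succ,
      hN N le_rfl, map_zero, mul_zero, add_zero, ← Finset.sum_add_distrib]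
    refine Finset.sum_congr rfl fun k _ => ?_
    rw [Derivation.leibniz, smul_eq_mul, smul_eq_mul]
    ring
  rw [map_sum, h3]
  simp only [hw.succ, mul_add, Finset.sum_add_distrib]
  ring

theorem totalT_totalX (α : ℝ) (f : SmoothFun) :
    totalT α (totalX f) = totalX (totalT α f) := by
  have h1 := totalX_field _ isDerivativeTower_u (fun k => X (Coord.ut k)) f
  have h2 := totalX_field _ isDerivativeTower_ut (fun k => totalX^[k] (rhsFun α)) f
  simp only [totalX_X_ut, ← Function.iterate_succ_apply' totalX] at h1 h2
  rw [add_left_inj] at h1 h2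
  rw [totalT_apply, totalT_apply, map_add, map_add, h1, h2, par_t_totalX]

theorem totalT_iterate_totalX (α : ℝ) (k : ℕ) (f : SmoothFun) :
    totalT α (totalX^[k] f) = totalX^[k] (totalT α f) :=
  Function.Commute.iterate_right (totalT_totalX α) k f

theorem IsDerivativeTower.par_totalX_eq_zero {w : ℕ → Coord} (hw : IsDerivativeTower w)
    {f : SmoothFun} {N : ℕ} (h : ∀ k, N ≤ k → par (w k) f = 0) :
    ∀ k, N + 1 ≤ k → par (w k) (totalX f) = 0 := by
  rintro (_ | k) hk
  · omega
  · rw [hw.succ, h k (by omega), h _ (by omega), map_zero, add_zero]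

theorem IsDerivativeTower.par_iterate_totalX_eq_zero {w : ℕ → Coord} (hw : IsDerivativeTower w)
    {f : SmoothFun} {N : ℕ} (h : ∀ k, N ≤ k → par (w k) f = 0) (j : ℕ) :
    ∀ k, N + j ≤ k → par (w k) (totalX^[j] f) = 0 := by
  induction j with
  | zero => exact h
  | succ j ih =>
    rw [Function.iterate_succ_apply']
    exact hw.par_totalX_eq_zero ih

/-- The highest derivative enters an iterated total derivative linearly. -/
theorem IsDerivativeTower.par_iterate_totalX {w : ℕ → Coord} (hw : IsDerivativeTower w)
    {f : SmoothFun} {N : ℕ} (h : ∀ k, N + 1 ≤ k → par (w k) f = 0) (j : ℕ) :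
    par (w (N + j)) (totalX^[j] f) = par (w N) f := by
  induction j with
  | zero => rfl
  | succ j ih =>
    rw [Function.iterate_succ_apply', ← add_assoc, hw.succ, ih,
      hw.par_iterate_totalX_eq_zero h j _ (by omega), map_zero, zero_add]

theorem par_damping_of_ne {c : Coord} (hc : c ≠ Coord.t) (α : ℝ) : par c (damping α) = 0 := by
  rw [damping, Derivation.map_smul, par_tpow_of_ne hc, smul_zero]

theorem par_rhsFun {c : Coord} (hc : c ≠ Coord.t) (α : ℝ) :
    par c (rhsFun α) = -par c (X (Coord.u 3)) + (X (Coord.u 1) * par c (X (Coord.u 2))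
      + X (Coord.u 2) * par c (X (Coord.u 1))) - damping α * par c (X (Coord.ut 0)) := by
  simp [rhsFun, Derivation.leibniz, par_damping_of_ne hc]

theorem par_u_rhsFun_eq_zero (α : ℝ) (k : ℕ) (hk : 4 ≤ k) : par (Coord.u k) (rhsFun α) = 0 := by
  have h1 : k ≠ 1 := by omega
  have h2 : k ≠ 2 := by omega
  have h3 : k ≠ 3 := by omega
  simp [par_rhsFun, par_X, h1, h2, h3]

theorem par_u_iterate_rhsFun_eq_zero (α : ℝ) {j k : ℕ} (hk : 4 + j ≤ k) :
    par (Coord.u k) (totalX^[j] (rhsFun α)) = 0 :=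
  isDerivativeTower_u.par_iterate_totalX_eq_zero (par_u_rhsFun_eq_zero α) j k hk

theorem par_u_iterate_rhsFun (α : ℝ) (j : ℕ) :
    par (Coord.u (3 + j)) (totalX^[j] (rhsFun α)) = -1 := by
  rw [isDerivativeTower_u.par_iterate_totalX (par_u_rhsFun_eq_zero α)]
  simp [par_rhsFun, par_X]

/-- Among the `v_k`, only `v_0` occurs in the right-hand side `F`, and its coefficient `-α/t` is
annihilated by `D_x`; so `D_x^j F` involves only `v_j`, with the same coefficient. -/
theorem par_ut_iterate_rhsFun (α : ℝ) (j k : ℕ) :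
    par (Coord.ut k) (totalX^[j] (rhsFun α)) = if j = k then -damping α else 0 := by
  induction j generalizing k with
  | zero => rcases k with _ | k <;> simp [par_rhsFun, par_X]
  | succ j ih =>
    rw [Function.iterate_succ_apply']
    rcases k with _ | k
    · rw [isDerivativeTower_ut.zero, ih]
      split_ifs with h1 h2 <;> simp_all [totalX_damping]
    · rw [isDerivativeTower_ut.succ, ih, ih]
      split_ifs <;> simp_all [totalX_damping]

theorem par_ut_totalT (α : ℝ) (k : ℕ) (f : SmoothFun) : par (Coord.ut k) (totalT α f) =
    totalT α (par (Coord.ut k) f) + par (Coord.u k) f - damping α * par (Coord.ut k) f := by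
  rw [par_totalT, field_eq_single u_injective _ k, field_eq_single ut_injective _ k, par_X_self,
    par_ut_iterate_rhsFun, if_pos rfl]
  · ring
  · intro j hj
    rw [par_ut_iterate_rhsFun, if_neg hj]
    exact Or.inl rfl
  · exact fun j hj => Or.inl (par_X_of_ne (by simpa using hj.symm))

theorem par_u_totalT (α : ℝ) (k : ℕ) (f : SmoothFun) : par (Coord.u k) (totalT α f) =
    totalT α (par (Coord.u k) f)
      + field ut_injective (fun j => par (Coord.u k) (totalX^[j] (rhsFun α))) f := by
  rw [par_totalT, field_eq_zero u_injective, add_zero]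
  exact fun j => Or.inl (par_X_of_ne (by simp))

end Commutators

end ViscousTransonic
end

noncomputable section
namespace ViscousTransonic

/-! ### Euler operators and their kernels -/

section Euler

/-- The operator `-D_x`. -/
def negX : Module.End ℝ SmoothFun := -(totalX : SmoothFun →ₗ[ℝ] SmoothFun)

theorem negX_apply (f : SmoothFun) : negX f = -totalX f := rfl

theorem negX_pow_succ_apply (k : ℕ) (f : SmoothFun) :
    (negX ^ (k + 1)) f = (negX ^ k) (negX f) := by rw [pow_succ, Module.End.mul_apply]

theorem negX_pow_apply (k : ℕ) (f : SmoothFun) :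
    (negX ^ k) f = (-1 : ℝ) ^ k • totalX^[k] f := by
  induction k generalizing f with
  | zero => simp
  | succ k ih =>
    rw [negX_pow_succ_apply, negX_apply, map_neg, ih, Function.iterate_succ_apply, pow_succ,
      mul_neg_one, neg_smul]

/-- The alternating sum `∑ₖ (-D_x)ᵏ hₖ`. -/
def altSum (h : ℕ → SmoothFun) : SmoothFun := ∑ᶠ k, (negX ^ k) (h k)

theorem altSum_eq_sum {h : ℕ → SmoothFun} {N : ℕ} (hN : ∀ k, N ≤ k → h k = 0) :
    altSum h = ∑ k ∈ Finset.range N, (negX ^ k) (h k) :=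
  finsum_eq_sum_range fun k hk => by rw [hN k hk, map_zero]

/-- The Euler operator (variational derivative) of a tower of coordinates. -/
def euler (w : ℕ → Coord) (f : SmoothFun) : SmoothFun := altSum fun k => par (w k) f

variable {w : ℕ → Coord}

theorem euler_add (hw : IsDerivativeTower w) (f g : SmoothFun) :
    euler w (f + g) = euler w f + euler w g := by
  obtain ⟨N, hf, hg⟩ := exists_par_eq_zero₂ hw.injective f g
  rw [euler, euler, euler, altSum_eq_sum hf, altSum_eq_sum hg, altSum_eq_sum (N := N),
    ← Finset.sum_add_distrib]
  · simp
  · intro k hk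
    rw [map_add, hf k hk, hg k hk, add_zero]

theorem euler_smul (hw : IsDerivativeTower w) (a : ℝ) (f : SmoothFun) :
    euler w (a • f) = a • euler w f := by
  obtain ⟨N, hf⟩ := exists_par_eq_zero hw.injective f
  rw [euler, euler, altSum_eq_sum hf, altSum_eq_sum (N := N), Finset.smul_sum]
  · simp
  · intro k hk
    rw [Derivation.map_smul, hf k hk, smul_zero]

theorem euler_neg (hw : IsDerivativeTower w) (f : SmoothFun) : euler w (-f) = -euler w f := by
  rw [← neg_one_smul ℝ f, euler_smul hw, neg_one_smul]

/-- Integration by parts: `∂/∂w_{k+1}` produces the extra term `∂f/∂w_k` when it passes `D_x`. By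
Leibniz the sums of terms containing `D_x (∂f/∂w_k)` cancel after a shift of index. The case `g = 1`
gives `E(D_x f) = 0`. -/
theorem altSum_par_totalX_mul (hw : IsDerivativeTower w) (f g : SmoothFun) :
    altSum (fun k => par (w k) (totalX f) * g) = altSum (fun k => par (w k) f * negX g) := by
  obtain ⟨N, hN⟩ := exists_par_eq_zero hw.injective f
  rw [altSum_eq_sum (N := N + 1), altSum_eq_sum (N := N), Finset.sum_range_succ', hw.zero]
  · have h1 : ∀ k, par (w k) f * negX g =
        totalX (par (w k) f) * g + negX (par (w k) f * g) := by
      intro k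
      rw [negX_apply, negX_apply, Derivation.leibniz, smul_eq_mul, smul_eq_mul]
      ring
    simp only [hw.succ, h1, add_mul, map_add, Finset.sum_add_distrib, ← negX_pow_succ_apply]
    have h2 := Finset.sum_range_succ' (fun k => (negX ^ k) (totalX (par (w k) f) * g)) N
    rw [Finset.sum_range_succ, hN N le_rfl, map_zero, zero_mul, map_zero, add_zero] at h2
    rw [h2]
    simp only [negX_pow_succ_apply]
    abel
  · intro k hk
    rw [hN k hk, zero_mul]
  · intro k hk
    rw [hw.par_totalX_eq_zero hN k hk, zero_mul]

/-- The formal adjoint of a total derivative under the Euler operator. -/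
theorem altSum_par_iterate_totalX_mul (hw : IsDerivativeTower w) (j : ℕ) (f g : SmoothFun) :
    altSum (fun k => par (w k) (totalX^[j] f) * g) =
      altSum (fun k => par (w k) f * (negX ^ j) g) := by
  induction j generalizing g with
  | zero => rfl
  | succ j ih =>
    simp only [Function.iterate_succ_apply']
    rw [altSum_par_totalX_mul hw, ih]
    simp only [negX_pow_succ_apply]

theorem euler_totalX (hw : IsDerivativeTower w) (f : SmoothFun) : euler w (totalX f) = 0 := by
  have h := altSum_par_totalX_mul hw f 1
  simp only [mul_one, negX_apply, Derivation.map_one_eq_zero, neg_zero, mul_zero] at h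
  rw [euler, h, altSum_eq_sum (N := 0) (fun _ _ => rfl), Finset.sum_range_zero]

theorem totalT_negX_pow (α : ℝ) (k : ℕ) (f : SmoothFun) :
    totalT α ((negX ^ k) f) = (negX ^ k) (totalT α f) := by
  rw [negX_pow_apply, negX_pow_apply, Derivation.map_smul, totalT_iterate_totalX]

theorem negX_pow_damping_mul (α : ℝ) (k : ℕ) (f : SmoothFun) :
    (negX ^ k) (damping α * f) = damping α * (negX ^ k) f := by
  induction k generalizing f with
  | zero => rfl
  | succ k ih =>
    rw [negX_pow_succ_apply, negX_pow_succ_apply, ← ih, negX_apply, Derivation.leibniz,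
      totalX_damping, smul_zero, add_zero, smul_eq_mul, negX_apply]
    exact congrArg _ (by ring)

/-- The commutator of `∂/∂v_k` and `D_t` is `∂/∂u_k - (α/t) ∂/∂v_k`; it is summed with signs, as
`(-D_x)^k` commutes with `D_t` and with multiplication by `α/t`. -/
theorem euler_ut_totalT (α : ℝ) (f : SmoothFun) : euler Coord.ut (totalT α f) =
    totalT α (euler Coord.ut f) + euler Coord.u f - damping α * euler Coord.ut f := by
  obtain ⟨N, hN⟩ := exists_par_eq_zero u_injective f
  obtain ⟨M, hM⟩ := exists_par_eq_zero ut_injective f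
  have hN' : ∀ k, max N M ≤ k → par (Coord.u k) f = 0 := fun k hk => hN k (le_of_max_le_left hk)
  have hM' : ∀ k, max N M ≤ k → par (Coord.ut k) f = 0 :=
    fun k hk => hM k (le_of_max_le_right hk)
  rw [euler, euler, euler, altSum_eq_sum hN', altSum_eq_sum hM', altSum_eq_sum (N := max N M)]
  · simp only [par_ut_totalT, map_add, map_sub, map_sum, totalT_negX_pow, negX_pow_damping_mul,
      Finset.sum_add_distrib, Finset.sum_sub_distrib, Finset.mul_sum]
  · intro k hk
    rw [par_ut_totalT, hN' k hk, hM' k hk]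
    simp

/-- The `u`-linearization of the right-hand side is `-D_x³ + D_x ∘ u_1 D_x`. Its formal adjoint
reverses the sign of the odd-order first term and keeps the second. -/
theorem altSum_par_u_rhsFun_mul (α : ℝ) (g : SmoothFun) :
    altSum (fun k => par (Coord.u k) (rhsFun α) * g) =
      totalX (totalX (totalX g)) + totalX (X (Coord.u 1) * totalX g) := by
  rw [altSum_eq_sum (N := 4)]
  · simp only [Finset.sum_range_succ, Finset.sum_range_zero, negX_pow_succ_apply, negX_apply]
    simp [par_rhsFun, par_X, totalX_X_u, Derivation.leibniz]
    ring
  · intro k hk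
    rw [par_u_rhsFun_eq_zero α k hk, zero_mul]

theorem altSum_sum {s : Finset ℕ} {h : ℕ → ℕ → SmoothFun} {N : ℕ}
    (hN : ∀ j ∈ s, ∀ k, N ≤ k → h j k = 0) :
    altSum (fun k => ∑ j ∈ s, h j k) = ∑ j ∈ s, altSum (h j) := by
  rw [altSum_eq_sum (N := N), Finset.sum_congr rfl fun j hj => altSum_eq_sum (hN j hj),
    Finset.sum_comm]
  · simp only [map_sum]
  · exact fun k hk => Finset.sum_eq_zero fun j hj => hN j hj k hk

/-- Passing `∂/∂u_k` through `D_t` leaves `∑_j ∂(D_x^j F)/∂u_k · ∂f/∂v_j`. Moving each `D_x^j` to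
the other factor assembles `E_v f`, on which the adjoint linearization of `F` acts. -/
theorem euler_u_totalT (α : ℝ) (f : SmoothFun) : euler Coord.u (totalT α f) =
    totalT α (euler Coord.u f) + totalX (totalX (totalX (euler Coord.ut f)))
      + totalX (X (Coord.u 1) * totalX (euler Coord.ut f)) := by
  obtain ⟨N, hN⟩ := exists_par_eq_zero u_injective f
  obtain ⟨M, hM⟩ := exists_par_eq_zero ut_injective f
  -- `D_x^j F` contains no `u_k` with `k ≥ 4 + j`, and only `j < M` contribute.
  let P := max N (4 + M)
  have hN' : ∀ k, P ≤ k → par (Coord.u k) f = 0 := fun k hk => hN k (le_of_max_le_left hk)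
  have hF : ∀ j ∈ Finset.range M, ∀ k, P ≤ k →
      par (Coord.u k) (totalX^[j] (rhsFun α)) * par (Coord.ut j) f = 0 := by
    intro j hj k hk
    have := le_of_max_le_right hk
    have := Finset.mem_range.1 hj
    rw [par_u_iterate_rhsFun_eq_zero α (by omega), zero_mul]
  have h1 : ∀ k, par (Coord.u k) (totalT α f) = totalT α (par (Coord.u k) f) +
      ∑ j ∈ Finset.range M, par (Coord.u k) (totalX^[j] (rhsFun α)) * par (Coord.ut j) f := by
    intro k
    rw [par_u_totalT, field_apply_sum _ _ hM]
  have h2 : altSum (fun k => ∑ j ∈ Finset.range M,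
      par (Coord.u k) (totalX^[j] (rhsFun α)) * par (Coord.ut j) f) =
      altSum (fun k => par (Coord.u k) (rhsFun α) * euler Coord.ut f) := by
    rw [altSum_sum hF, euler, altSum_eq_sum hM]
    simp only [Finset.mul_sum]
    rw [altSum_sum (N := 4)]
    · exact Finset.sum_congr rfl fun j _ =>
        altSum_par_iterate_totalX_mul isDerivativeTower_u j _ _
    · intro j _ k hk
      rw [par_u_rhsFun_eq_zero α k hk, zero_mul]
  rw [add_assoc, ← altSum_par_u_rhsFun_mul α, ← h2, euler, euler, altSum_eq_sum hN',
    altSum_eq_sum (N := P), altSum_eq_sum (N := P), map_sum, ← Finset.sum_add_distrib]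
  · simp only [h1, map_add, totalT_negX_pow]
  · exact fun k hk => Finset.sum_eq_zero fun j hj => hF j hj k hk
  · intro k hk
    rw [h1, hN' k hk, map_zero, zero_add]
    exact Finset.sum_eq_zero fun j hj => hF j hj k hk

theorem IsDerivativeTower.par_totalX_of_forall_eq_zero (hw : IsDerivativeTower w) {f : SmoothFun}
    (h : ∀ k, par (w k) f = 0) (k : ℕ) : par (w k) (totalX f) = 0 := by
  rcases k with _ | k
  · rw [hw.zero, h, map_zero]
  · rw [hw.succ, h, h, map_zero, add_zero]

/-- The Euler operators detect total `x`-derivatives, one tower at a time. -/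
theorem IsDerivativeTower.exists_sub_totalX (hw : IsDerivativeTower w) {f : SmoothFun}
    (hf : euler w f = 0) : ∃ L, (∀ k, par (w k) (f - totalX L) = 0) ∧
      ∀ v, IsDerivativeTower v → (∀ j k, w j ≠ v k) → (∀ k, par (v k) f = 0) →
        ∀ k, par (v k) L = 0 := by
  obtain ⟨N, hN⟩ := exists_par_eq_zero hw.injective f
  induction N generalizing f with
  | zero => exact ⟨0, by simpa using hN, fun v _ _ _ k => map_zero _⟩
  | succ m ih =>
    have hN' : ∀ i k, m + 1 ≤ k → par (w k) (par (w i) f) = 0 := fun i k hk => by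
      rw [par_comm, hN k hk, map_zero]
    rcases m with _ | m
    · refine ih hf fun k _ => ?_
      rcases k with _ | k
      · rwa [euler, altSum_eq_sum hN, Finset.sum_range_one] at hf
      · exact hN _ (by omega)
    · have htop : par (w (m + 1)) (par (w (m + 1)) f) = 0 := by
        have h1 := congrArg (par (w ((m + 1) + (m + 1)))) hf
        rw [euler, altSum_eq_sum hN, map_zero, map_sum, Finset.sum_range_succ,
          Finset.sum_eq_zero, zero_add, negX_pow_apply, Derivation.map_smul,
          hw.par_iterate_totalX (hN' _)] at h1
        · simpa using h1
        · intro k hk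
          have := Finset.mem_range.1 hk
          rw [negX_pow_apply, Derivation.map_smul,
            hw.par_iterate_totalX_eq_zero (hN' k) k _ (by omega), smul_zero]
      -- With `∂A/∂w_m = ∂f/∂w_{m+1}`, the function `D_x A` has the same `w_{m+1}`-derivative as
      -- `f`, so subtracting it lowers the order.
      obtain ⟨A, hA1, hA2⟩ := exists_primitive (par (w (m + 1)) f) (w m)
      have hne : ∀ k, m + 1 ≤ k → w k ≠ w m := fun k hk h => by
        have := hw.injective h
        omega
      have hA3 : ∀ k, m + 1 ≤ k → par (w k) A = 0 := by
        intro k hk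
        refine hA2 _ (hne k hk) ?_
        rcases hk.eq_or_lt with rfl | hk
        · exact htop
        · exact hN' _ _ hk
      have h2 : ∀ k, m + 1 ≤ k → par (w k) (f - totalX A) = 0 := by
        intro k hk
        obtain ⟨k, rfl⟩ : ∃ i, k = i + 1 := ⟨k - 1, by omega⟩
        rw [map_sub, hw.succ, hA3 _ hk, map_zero, zero_add]
        rcases hk.eq_or_lt with h | h
        · obtain rfl : m = k := by omega
          rw [hA1, sub_self]
        · rw [hN _ h, hA3 k (by omega), sub_self]
      have h3 : euler w (f - totalX A) = 0 := by
        rw [sub_eq_add_neg, euler_add hw, euler_neg hw, euler_totalX hw, hf, neg_zero, add_zero]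
      obtain ⟨L, hL1, hL2⟩ := ih h3 h2
      refine ⟨A + L, ?_, ?_⟩
      · intro k
        rw [map_add, ← sub_sub]
        exact hL1 k
      · intro v hv hc h0
        have hvA : ∀ k, par (v k) A = 0 := fun k =>
          hA2 _ (hc m k).symm (by rw [par_comm, h0, map_zero])
        intro k
        rw [map_add, hvA, zero_add]
        refine hL2 v hv hc (fun k => ?_) k
        rw [map_sub, h0, hv.par_totalX_of_forall_eq_zero hvA, sub_zero]

end Euler

end ViscousTransonic
end

noncomputable section
namespace ViscousTransonic

/-! ### Determination of all characteristics -/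

section Cosymmetries

/-- The equation satisfied by the characteristics of conservation laws. -/
def IsCosymmetry (α : ℝ) (χ : SmoothFun) : Prop :=
  totalT α (totalT α χ) - totalT α (damping α * χ) =
    totalX (totalX (totalX χ)) + totalX (X (Coord.u 1) * totalX χ)

theorem euler_u_of_conserved {α : ℝ} {f g : SmoothFun} (h : totalT α f + totalX g = 0) :
    euler Coord.u f = damping α * euler Coord.ut f - totalT α (euler Coord.ut f) := by
  have h1 := euler_ut_totalT α f
  rw [eq_neg_of_add_eq_zero_left h, euler_neg isDerivativeTower_ut,
    euler_totalX isDerivativeTower_ut] at h1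
  linear_combination -h1

theorem isCosymmetry_of_conserved {α : ℝ} {f g : SmoothFun} (h : totalT α f + totalX g = 0) :
    IsCosymmetry α (euler Coord.ut f) := by
  have h1 := euler_u_totalT α f
  rw [eq_neg_of_add_eq_zero_left h, euler_neg isDerivativeTower_u,
    euler_totalX isDerivativeTower_u, euler_u_of_conserved h, map_sub] at h1
  rw [IsCosymmetry]
  linear_combination h1

theorem eq_zero_of_neg_eq_self {f : SmoothFun} (h : -f = f) : f = 0 := by
  have h2 : (2 : ℝ) • f = 0 := by
    rw [two_smul]
    nth_rewrite 1 [← h]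
    exact neg_add_cancel f
  rw [← one_smul ℝ f, ← inv_mul_cancel₀ (two_ne_zero (α := ℝ)), mul_smul, h2, smul_zero]

variable {α : ℝ} {χ : SmoothFun}

theorem par_damping_mul {c : Coord} (hc : c ≠ Coord.t) (f : SmoothFun) :
    par c (damping α * f) = damping α * par c f := by
  rw [Derivation.leibniz, par_damping_of_ne hc, smul_zero, add_zero, smul_eq_mul]

/-- The commutator of `∂/∂u_{n+3}` and `D_t` picks out `∂/∂(u_t)_n`. -/
theorem par_u_totalT_of_forall {n : ℕ} {f : SmoothFun}
    (hb : ∀ k, n + 1 ≤ k → par (Coord.ut k) f = 0) :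
    par (Coord.u (3 + n)) (totalT α f) =
      totalT α (par (Coord.u (3 + n)) f) - par (Coord.ut n) f := by
  rw [par_u_totalT, field_eq_single _ _ n, par_u_iterate_rhsFun]
  · ring
  · intro j hj
    rcases lt_or_gt_of_ne hj with hj | hj
    · exact Or.inl (par_u_iterate_rhsFun_eq_zero α (by omega))
    · exact Or.inr (hb j hj)

/-- The nonlinear term raises the order by at most two, so it cannot interfere with the leading part
of `D_x³ χ`. -/
theorem IsDerivativeTower.par_totalX_X_mul_totalX {w : ℕ → Coord} (hw : IsDerivativeTower w)
    (hw1 : ∀ k, 2 ≤ k → w k ≠ Coord.u 1) {n : ℕ} (h : ∀ k, n + 1 ≤ k → par (w k) χ = 0) :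
    par (w (n + 3)) (totalX (X (Coord.u 1) * totalX χ)) = 0 := by
  refine hw.par_totalX_eq_zero (N := n + 2) (fun k hk => ?_) _ le_rfl
  rw [Derivation.leibniz, hw.par_totalX_eq_zero h k hk, par_X_of_ne (hw1 k (by omega)), smul_zero,
    smul_zero, add_zero]

/-- In the derivative of the cosymmetry equation along `v_{m+3}`, the right side gives `∂χ/∂v_m`
through `D_x³`. The left side gives `-∂χ/∂v_m`: `v_{m+3}` comes from `u_{m+3}` under one `D_t`, and
`u_{m+3}` from `v_m` under the other, with coefficient `-1`. -/
theorem IsCosymmetry.par_ut_eq_zero (hχ : IsCosymmetry α χ) {m : ℕ}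
    (ha : ∀ k, m + 2 ≤ k → par (Coord.u k) χ = 0)
    (hb : ∀ k, m + 1 ≤ k → par (Coord.ut k) χ = 0) : par (Coord.ut m) χ = 0 := by
  have hT : ∀ k, m + 2 ≤ k → par (Coord.ut k) (totalT α χ) = 0 := fun k hk => by
    rw [par_ut_totalT, hb k (by omega), ha k hk]
    simp
  have h1 : par (Coord.ut (m + 3)) (totalX (totalX (totalX χ))) = par (Coord.ut m) χ :=
    isDerivativeTower_ut.par_iterate_totalX hb 3
  have h2 : par (Coord.u (m + 3)) (totalT α χ) = -par (Coord.ut m) χ := by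
    rw [add_comm m 3, par_u_totalT_of_forall hb, ha _ (by omega), map_zero, zero_sub]
  have h := congrArg (par (Coord.ut (m + 3))) hχ
  rw [map_sub, map_add, h1,
    isDerivativeTower_ut.par_totalX_X_mul_totalX (fun _ _ => by simp) hb,
    par_ut_totalT α _ (totalT α χ), par_ut_totalT α _ (damping α * χ), hT (m + 3) (by omega), h2,
    par_damping_mul (by simp), par_damping_mul (by simp), hb (m + 3) (by omega),
    ha (m + 3) (by omega)] at h
  apply eq_zero_of_neg_eq_self
  simpa using h

/-- The same sign conflict along `u_{n+3}`: now `u_n` passes to `v_n` and then to `-u_{n+3}` under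
`D_t²`. -/
theorem IsCosymmetry.par_u_eq_zero (hχ : IsCosymmetry α χ) {n : ℕ}
    (ha : ∀ k, n + 1 ≤ k → par (Coord.u k) χ = 0)
    (hb : ∀ k, n ≤ k + 1 → par (Coord.ut k) χ = 0) : par (Coord.u n) χ = 0 := by
  have hb' : ∀ k, n + 1 ≤ k → par (Coord.ut k) χ = 0 := fun k hk => hb k (by omega)
  have hT : ∀ k, n ≤ k → par (Coord.ut k) (totalT α χ) = par (Coord.u k) χ := fun k hk => by
    rw [par_ut_totalT, hb k (by omega)]
    simp
  have h1 : par (Coord.u (n + 3)) (totalX (totalX (totalX χ))) = par (Coord.u n) χ :=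
    isDerivativeTower_u.par_iterate_totalX ha 3
  have h := congrArg (par (Coord.u (n + 3))) hχ
  rw [map_sub, map_add, h1,
    isDerivativeTower_u.par_totalX_X_mul_totalX (fun k hk => by simp; omega) ha, add_comm n 3,
    par_u_totalT_of_forall fun k hk => by rw [hT k (by omega), ha k hk],
    par_u_totalT_of_forall hb', hT n le_rfl, par_u_totalT_of_forall
    fun k hk => by rw [par_damping_mul (by simp), hb' k hk, mul_zero], par_damping_mul (by simp),
    par_damping_mul (by simp), ha _ (by omega), hb n (by omega)] at h
  apply eq_zero_of_neg_eq_self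
  simpa using h

/-- The function depends on `t` and `x` only. -/
structure IsBasic (f : SmoothFun) : Prop where
  u : ∀ k, par (Coord.u k) f = 0
  ut : ∀ k, par (Coord.ut k) f = 0

theorem IsBasic.par {f : SmoothFun} (hf : IsBasic f) (c : Coord) :
    IsBasic (ViscousTransonic.par c f) where
  u k := by rw [par_comm, hf.u, map_zero]
  ut k := by rw [par_comm, hf.ut, map_zero]

theorem IsBasic.damping_mul {f : SmoothFun} (hf : IsBasic f) : IsBasic (damping α * f) where
  u k := by rw [par_damping_mul (by simp), hf.u, mul_zero]
  ut k := by rw [par_damping_mul (by simp), hf.ut, mul_zero]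

theorem IsBasic.totalX_eq {f : SmoothFun} (hf : IsBasic f) :
    totalX f = ViscousTransonic.par Coord.x f := by
  rw [totalX_apply, field_eq_zero _ _ fun k => Or.inr (hf.u k),
    field_eq_zero _ _ fun k => Or.inr (hf.ut k), add_zero, add_zero]

theorem IsBasic.totalT_eq {f : SmoothFun} (hf : IsBasic f) :
    totalT α f = ViscousTransonic.par Coord.t f := by
  rw [totalT_apply, field_eq_zero _ _ fun k => Or.inr (hf.u k),
    field_eq_zero _ _ fun k => Or.inr (hf.ut k), add_zero, add_zero]

/-- Cosymmetries do not depend on `u` and its derivatives. -/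
theorem IsCosymmetry.isBasic (hχ : IsCosymmetry α χ) : IsBasic χ := by
  obtain ⟨N, hN⟩ := exists_par_eq_zero u_injective χ
  obtain ⟨M, hM⟩ := exists_par_eq_zero ut_injective χ
  -- Since `D_t²` counts as three `x`-derivatives, `v_k` ranks between `u_{k+1}` and `u_{k+2}`. The
  -- descent therefore alternates, removing `v_P` before `u_{P+1}`.
  have key : ∀ P, (∀ k, P + 1 ≤ k → ViscousTransonic.par (Coord.u k) χ = 0) →
      (∀ k, P ≤ k → ViscousTransonic.par (Coord.ut k) χ = 0) → IsBasic χ := by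
    intro P
    induction P with
    | zero =>
      intro ha hb
      refine ⟨fun k => ?_, fun k => hb k (Nat.zero_le k)⟩
      rcases k with _ | k
      · exact hχ.par_u_eq_zero ha fun k _ => hb k (Nat.zero_le k)
      · exact ha _ (by omega)
    | succ P ih =>
      intro ha hb
      have hb' : ∀ k, P ≤ k → ViscousTransonic.par (Coord.ut k) χ = 0 := by
        intro k hk
        rcases hk.eq_or_lt with rfl | hk
        · exact hχ.par_ut_eq_zero ha hb
        · exact hb k hk
      refine ih (fun k hk => ?_) hb'
      rcases hk.eq_or_lt with rfl | hk
      · exact hχ.par_u_eq_zero ha fun k hk => hb' k (by omega)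
      · exact ha k hk
  exact key (max N M) (fun k hk => hN k (by omega)) fun k hk => hM k (by omega)

/-- For `χ` depending on `t` and `x` only, `u_2` occurs in the cosymmetry equation just once, in
`u_2 χ_x`. -/
theorem IsCosymmetry.par_x_eq_zero (hχ : IsCosymmetry α χ) : par Coord.x χ = 0 := by
  have hB := hχ.isBasic
  have h := congrArg (ViscousTransonic.par (Coord.u 2)) hχ
  rw [hB.totalT_eq, (hB.par _).totalT_eq, hB.damping_mul.totalT_eq, hB.totalX_eq,
    (hB.par _).totalX_eq, ((hB.par _).par _).totalX_eq, Derivation.leibniz totalX, totalX_X_u,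
    (hB.par _).totalX_eq, map_sub, map_add, map_add, ((hB.par _).par _).u,
    (hB.damping_mul.par _).u, (((hB.par _).par _).par _).u, smul_eq_mul, smul_eq_mul,
    Derivation.leibniz, Derivation.leibniz, (hB.par _).u, ((hB.par _).par _).u,
    par_X_of_ne (by simp), par_X_self] at h
  simpa using h.symm

theorem exists_eq_algebraMap_of_par_t {f : SmoothFun} (hf : IsBasic f) (hx : par Coord.x f = 0)
    (ht : par Coord.t f = 0) : ∃ a : ℝ, f = algebraMap ℝ SmoothFun a := by
  refine exists_eq_algebraMap fun c => ?_
  rcases c with _ | _ | k | k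
  exacts [ht, hx, hf.u k, hf.ut k]

theorem isBasic_tpow (a : ℝ) : IsBasic (tpow a) where
  u k := par_tpow_of_ne (by simp) a
  ut k := par_tpow_of_ne (by simp) a

theorem damping_mul_X_t : damping α * X Coord.t = algebraMap ℝ SmoothFun α := by
  rw [damping, ← tpow_one, smul_mul_assoc, tpow_mul, neg_add_cancel, tpow_zero,
    Algebra.algebraMap_eq_smul_one]

theorem IsBasic.mul {f g : SmoothFun} (hf : IsBasic f) (hg : IsBasic g) : IsBasic (f * g) where
  u k := by rw [Derivation.leibniz, hf.u, hg.u, smul_zero, smul_zero, add_zero]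
  ut k := by rw [Derivation.leibniz, hf.ut, hg.ut, smul_zero, smul_zero, add_zero]

theorem IsBasic.sub {f g : SmoothFun} (hf : IsBasic f) (hg : IsBasic g) : IsBasic (f - g) where
  u k := by rw [map_sub, hf.u, hg.u, sub_zero]
  ut k := by rw [map_sub, hf.ut, hg.ut, sub_zero]

theorem IsBasic.smul {f : SmoothFun} (hf : IsBasic f) (a : ℝ) : IsBasic (a • f) where
  u k := by rw [Derivation.map_smul, hf.u, smul_zero]
  ut k := by rw [Derivation.map_smul, hf.ut, smul_zero]

/-- For `α ≠ 1` the cosymmetries are spanned by `t^α` and `t`. -/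
theorem IsCosymmetry.exists_eq (hα : α ≠ 1) (hχ : IsCosymmetry α χ) :
    ∃ a b : ℝ, χ = a • tpow α + b • X Coord.t := by
  have hB := hχ.isBasic
  have hx := hχ.par_x_eq_zero
  -- With no dependence on `x` left, the equation reads `(χ_t - (α/t) χ)_t = 0`, which integrates
  -- once to a constant `c`.
  obtain ⟨c, hc⟩ := exists_eq_algebraMap_of_par_t (f := par Coord.t χ - damping α * χ)
    ((hB.par _).sub hB.damping_mul)
    (by rw [map_sub, par_damping_mul (by simp), par_comm, hx, map_zero, mul_zero, sub_zero])
    (by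
      have h := hχ
      rw [IsCosymmetry, hB.totalT_eq, (hB.par _).totalT_eq, hB.damping_mul.totalT_eq,
        hB.totalX_eq, hx] at h
      simpa using h)
  have hα' : 1 - α ≠ 0 := sub_ne_zero.2 hα.symm
  -- `b t` is a particular solution, because `b - α b = c`; this is where `α ≠ 1` enters. The
  -- remainder solves `y_t = (α/t) y`, so `t^(-α) y` is constant.
  let b := c / (1 - α)
  let y := χ - b • X Coord.t
  have hXt : IsBasic (X Coord.t) := tpow_one ▸ isBasic_tpow 1
  have hy : IsBasic y := hB.sub (hXt.smul b)
  have hyx : par Coord.x y = 0 := by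
    rw [map_sub, hx, Derivation.map_smul, par_X_of_ne (by simp), smul_zero, sub_zero]
  have hyt : par Coord.t y = damping α * y := by
    have h1 : b • (1 : SmoothFun) =
        algebraMap ℝ SmoothFun c + b • algebraMap ℝ SmoothFun α := by
      rw [Algebra.algebraMap_eq_smul_one, Algebra.algebraMap_eq_smul_one, smul_smul, ← add_smul]
      congr 1
      simp only [b]
      field_simp
      ring
    rw [map_sub, Derivation.map_smul, par_X_self, mul_sub, mul_smul_comm, damping_mul_X_t, h1,
      ← hc]
    abel
  obtain ⟨a, ha⟩ := exists_eq_algebraMap_of_par_t (f := tpow (-α) * y)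
    ((isBasic_tpow _).mul hy)
    (by rw [Derivation.leibniz, hyx, par_tpow_of_ne (by simp), smul_zero, smul_zero, add_zero])
    (by
      rw [Derivation.leibniz, hyt, par_t_tpow, damping, smul_eq_mul, smul_eq_mul, sub_eq_add_neg,
        ← tpow_mul]
      simp only [Algebra.smul_def, map_neg]
      ring)
  refine ⟨a, b, ?_⟩
  have h2 : y = a • tpow α := by
    calc y = tpow α * (tpow (-α) * y) := by
          rw [← mul_assoc, tpow_mul, add_neg_cancel, tpow_zero, one_mul]
      _ = a • tpow α := by rw [ha, Algebra.algebraMap_eq_smul_one, mul_smul_comm, mul_one]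
  rw [← h2]
  exact (sub_add_cancel _ _).symm

end Cosymmetries

/-! ### Exactness: currents with zero characteristic -/

section Exactness

/-- If `w_N` were the top coordinate in `f`, then `∂(D_x f)/∂w_{N+1} = ∂f/∂w_N` would be nonzero. -/
theorem IsDerivativeTower.par_eq_zero_of_totalX_eq_zero {w : ℕ → Coord}
    (hw : IsDerivativeTower w) {f : SmoothFun} (hf : totalX f = 0) (k : ℕ) :
    par (w k) f = 0 := by
  obtain ⟨N, hN⟩ := exists_par_eq_zero hw.injective f
  induction N with
  | zero => exact hN k (Nat.zero_le k)
  | succ N ih =>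
    refine ih fun j hj => ?_
    rcases hj.eq_or_lt with rfl | hj
    · have h := hw.succ N f
      rwa [hf, hN _ le_rfl, map_zero, map_zero, zero_add, eq_comm] at h
    · exact hN j hj

theorem isBasic_of_totalX_eq_zero {f : SmoothFun} (hf : totalX f = 0) : IsBasic f :=
  ⟨isDerivativeTower_u.par_eq_zero_of_totalX_eq_zero hf,
    isDerivativeTower_ut.par_eq_zero_of_totalX_eq_zero hf⟩

theorem IsBasic.exists_primitive {f : SmoothFun} (hf : IsBasic f) {c : Coord}
    (hu : ∀ k, Coord.u k ≠ c) (hut : ∀ k, Coord.ut k ≠ c) :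
    ∃ F, IsBasic F ∧ ViscousTransonic.par c F = f ∧
      ∀ d, d ≠ c → ViscousTransonic.par d f = 0 → ViscousTransonic.par d F = 0 := by
  obtain ⟨F, h1, h2⟩ := ViscousTransonic.exists_primitive f c
  exact ⟨F, ⟨fun k => h2 _ (hu k) (hf.u k), fun k => h2 _ (hut k) (hf.ut k)⟩, h1, h2⟩

/-- The common kernel of the Euler operators consists of total `x`-derivatives. -/
theorem exists_eq_totalX {f : SmoothFun} (hu : euler Coord.u f = 0)
    (hut : euler Coord.ut f = 0) : ∃ L, f = totalX L := by
  obtain ⟨L₁, h₁, -⟩ := isDerivativeTower_ut.exists_sub_totalX hut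
  have hu' : euler Coord.u (f - totalX L₁) = 0 := by
    rw [sub_eq_add_neg, euler_add isDerivativeTower_u, euler_neg isDerivativeTower_u,
      euler_totalX isDerivativeTower_u, hu, neg_zero, add_zero]
  obtain ⟨L₂, h₂, h₃⟩ := isDerivativeTower_u.exists_sub_totalX hu'
  -- Clearing the `u`-tower does not bring back the `v`-tower, so the remainder depends on `t` and
  -- `x` alone and is integrated in `x`.
  have h₄ := h₃ _ isDerivativeTower_ut (by simp) h₁
  have hB : IsBasic (f - totalX L₁ - totalX L₂) := ⟨h₂, fun k => by
    rw [map_sub, h₁, isDerivativeTower_ut.par_totalX_of_forall_eq_zero h₄, sub_zero]⟩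
  obtain ⟨L₃, hL₃, h₅, -⟩ := hB.exists_primitive (c := Coord.x) (by simp) (by simp)
  refine ⟨L₁ + L₂ + L₃, ?_⟩
  rw [map_add, map_add, hL₃.totalX_eq, h₅]
  abel

/-- A conserved current whose characteristic vanishes is trivial. -/
theorem exists_potential {α : ℝ} {f g : SmoothFun} (h : totalT α f + totalX g = 0)
    (hf : euler Coord.ut f = 0) : ∃ L, f = -totalX L ∧ g = totalT α L := by
  have hu : euler Coord.u f = 0 := by
    rw [euler_u_of_conserved h, hf, mul_zero, map_zero, sub_zero]
  obtain ⟨L, rfl⟩ := exists_eq_totalX hu hf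
  -- Hence `D_t L + g` is a function of `t` alone; adding its `t`-primitive `H` to `-L` corrects the
  -- flux and leaves the density unchanged.
  have h1 : totalX (totalT α L + g) = 0 := by rw [map_add, ← totalT_totalX, h]
  have hB := isBasic_of_totalX_eq_zero h1
  have hx : par Coord.x (totalT α L + g) = 0 := by rw [← hB.totalX_eq, h1]
  obtain ⟨H, hH, h2, h3⟩ := hB.exists_primitive (c := Coord.t) (by simp) (by simp)
  refine ⟨H - L, ?_, ?_⟩
  · rw [map_sub, hH.totalX_eq, h3 _ (by simp) hx]
    abel
  · rw [map_sub, hH.totalT_eq, h2]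
    abel

end Exactness

/-! ### The two conservation laws and their characteristics -/

section ConservationLaws

theorem isConserved_coe (α : ℝ) {f g : SmoothFun} (h : totalT α f + totalX g = 0) :
    IsConserved α (f.1, g.1) := by
  refine ⟨f.2, g.2, ?_⟩
  rw [← coe_totalT, ← coe_totalX]
  exact congrArg Subtype.val h

theorem IsConserved.exists_eq {α : ℝ} {J : Current} (hJ : IsConserved α J) :
    ∃ f g : SmoothFun, J = (f.1, g.1) ∧ totalT α f + totalX g = 0 := by
  obtain ⟨h1, h2, h3⟩ := hJ
  refine ⟨⟨J.1, h1⟩, ⟨J.2, h2⟩, rfl, Subtype.ext ?_⟩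
  refine Eq.trans ?_ h3
  exact congrArg₂ (· + ·) (coe_totalT α ⟨J.1, h1⟩) (coe_totalX ⟨J.2, h2⟩)

theorem characteristic_coe (f : SmoothFun) (g : JetSpace → ℝ) :
    characteristic (f.1, g) = (euler Coord.ut f).1 := by
  funext p
  obtain ⟨N, hN⟩ := exists_par_eq_zero ut_injective f
  have h1 : ∀ k, (-1 : ℝ) ^ k * Dx^[k] (pd (Coord.ut k) f.1) p =
      ((negX ^ k) (par (Coord.ut k) f)).1 p := by
    intro k
    rw [negX_pow_apply, ← coe_par, ← coe_iterate_totalX]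
    rfl
  rw [characteristic, euler, altSum_eq_sum hN, coe_sum_apply, finsum_eq_sum_range (N := N)]
  · exact Finset.sum_congr rfl fun k _ => h1 k
  · intro k hk
    rw [h1, hN k hk, map_zero]
    rfl

/-- Equivalent densities differ by a total `x`-derivative, which the Euler operator annihilates. -/
theorem isCharacteristicOf_coe (α : ℝ) (f g : SmoothFun) :
    IsCharacteristicOf α (f.1, g.1) (euler Coord.ut f).1 := by
  rintro J' hJ' ⟨L, hL, h1, -⟩
  obtain ⟨f', g', rfl, -⟩ := hJ'.exists_eq
  have h2 : f' = f + -totalX ⟨L, hL⟩ := by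
    apply Subtype.ext
    have h3 : f'.1 - f.1 = -Dx L := h1
    rw [← coe_totalX ⟨L, hL⟩] at h3
    rw [sub_eq_iff_eq_add'] at h3
    exact h3
  rw [characteristic_coe, h2, euler_add isDerivativeTower_ut, euler_neg isDerivativeTower_ut,
    euler_totalX isDerivativeTower_ut, neg_zero, add_zero]

/-- The density of the first current. -/
def densityA (α : ℝ) : SmoothFun := X (Coord.ut 0) * tpow α

/-- The flux of the first current. -/
def fluxA (α : ℝ) : SmoothFun :=
  X (Coord.u 2) * tpow α - (1 / 2 : ℝ) • (X (Coord.u 1) * X (Coord.u 1) * tpow α)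

/-- The density of the second current. -/
def densityB (α : ℝ) : SmoothFun := X (Coord.ut 0) * X Coord.t + (α - 1) • X (Coord.u 0)

/-- The flux of the second current. -/
def fluxB : SmoothFun :=
  X (Coord.u 2) * X Coord.t - (1 / 2 : ℝ) • (X (Coord.u 1) * X (Coord.u 1) * X Coord.t)

theorem currentA_eq (α : ℝ) : currentA α = ((densityA α).1, (fluxA α).1) := by
  refine Prod.ext rfl (funext fun p => ?_)
  change _ = coord (Coord.u 2) p * coord Coord.t p ^ α -
    1 / 2 * (coord (Coord.u 1) p * coord (Coord.u 1) p * coord Coord.t p ^ α)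
  simp only [currentA]
  ring

theorem currentB_eq (α : ℝ) : currentB α = ((densityB α).1, fluxB.1) := by
  refine Prod.ext rfl (funext fun p => ?_)
  change _ = coord (Coord.u 2) p * coord Coord.t p -
    1 / 2 * (coord (Coord.u 1) p * coord (Coord.u 1) p * coord Coord.t p)
  simp only [currentB]
  ring

/-- The undamped right-hand side is `-D_x(u_2 - u_1²/2)`, and `τ` passes through `D_x`. This treats
both currents at once, with `τ = t^α` and `τ = t`. -/
theorem conserved_of_flux {α : ℝ} {f τ : SmoothFun} (hτ : totalX τ = 0)
    (hf : totalT α f = rhsFun α * τ + damping α * τ * X (Coord.ut 0)) :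
    totalT α f + totalX (X (Coord.u 2) * τ -
      (1 / 2 : ℝ) • (X (Coord.u 1) * X (Coord.u 1) * τ)) = 0 := by
  have h2 : totalX ((1 / 2 : ℝ) • (X (Coord.u 1) * X (Coord.u 1) * τ)) =
      X (Coord.u 1) * X (Coord.u 2) * τ := by
    simp only [Derivation.map_smul, Derivation.leibniz, hτ, totalX_X_u, smul_eq_mul, mul_zero,
      zero_add]
    rw [← two_mul, ← mul_assoc, mul_comm τ, mul_assoc, ← smul_mul_assoc]
    have : (1 / 2 : ℝ) • (2 : SmoothFun) = 1 := by
      rw [← one_add_one_eq_two (R := SmoothFun), smul_add, ← add_smul]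
      norm_num
    rw [this]
    ring
  rw [hf, map_sub, h2, Derivation.leibniz, hτ, totalX_X_u, smul_zero, zero_add, smul_eq_mul,
    rhsFun]
  ring

theorem conserved_A (α : ℝ) : totalT α (densityA α) + totalX (fluxA α) = 0 := by
  refine conserved_of_flux (totalX_tpow α) ?_
  rw [densityA, Derivation.leibniz, totalT_tpow, totalT_X_ut, Function.iterate_zero, id, damping,
    sub_eq_neg_add, ← tpow_mul]
  simp only [smul_eq_mul, smul_mul_assoc, mul_smul_comm]
  rw [mul_comm (X (Coord.ut 0)), mul_comm (tpow α) (rhsFun α), add_comm]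

theorem totalT_X_t (α : ℝ) : totalT α (X Coord.t) = 1 := by
  rw [← tpow_one, totalT_tpow, sub_self, tpow_zero, one_smul]

theorem conserved_B (α : ℝ) : totalT α (densityB α) + totalX fluxB = 0 := by
  refine conserved_of_flux (by rw [← tpow_one, totalX_tpow]) ?_
  rw [densityB, map_add, Derivation.map_smul, Derivation.leibniz, totalT_X_t, totalT_X_ut,
    totalT_X_u, damping_mul_X_t, Function.iterate_zero, id, sub_smul, one_smul,
    Algebra.algebraMap_eq_smul_one, smul_mul_assoc, one_mul, smul_eq_mul, smul_eq_mul, mul_one,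
    mul_comm (X Coord.t)]
  abel

theorem euler_ut_X_mul (τ : SmoothFun) (hτ : IsBasic τ) :
    euler Coord.ut (X (Coord.ut 0) * τ) = τ := by
  rw [euler, altSum_eq_sum (N := 1)]
  · simp [Derivation.leibniz, hτ.ut, par_X_self]
  · intro k hk
    rw [Derivation.leibniz, hτ.ut, par_X_of_ne (by simp; omega), smul_zero, smul_zero, add_zero]

theorem euler_densityA (α : ℝ) : euler Coord.ut (densityA α) = tpow α :=
  euler_ut_X_mul _ (isBasic_tpow α)

theorem euler_densityB (α : ℝ) : euler Coord.ut (densityB α) = X Coord.t := by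
  rw [densityB, euler_add isDerivativeTower_ut, euler_smul isDerivativeTower_ut,
    euler_ut_X_mul _ (tpow_one ▸ isBasic_tpow 1), euler, altSum_eq_sum (N := 0)]
  · simp
  · exact fun k _ => par_X_of_ne (by simp)

end ConservationLaws

end ViscousTransonic
end

theorem mainTheorem8 (α : ℝ) :
    ViscousTransonic.IsConserved α (ViscousTransonic.currentA α) ∧
    ViscousTransonic.IsConserved α (ViscousTransonic.currentB α) ∧
    ViscousTransonic.IsCharacteristicOf α (ViscousTransonic.currentA α)
      (fun p => ViscousTransonic.coord ViscousTransonic.Coord.t p ^ α) ∧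
    ViscousTransonic.IsCharacteristicOf α (ViscousTransonic.currentB α)
      (fun p => ViscousTransonic.coord ViscousTransonic.Coord.t p) ∧
    (α ≠ 1 → ∀ J : ViscousTransonic.Current, ViscousTransonic.IsConserved α J →
      ∃ a b : ℝ, ViscousTransonic.Equivalent α J
        (a • ViscousTransonic.currentA α + b • ViscousTransonic.currentB α)) := by
  open ViscousTransonic in
  rw [currentA_eq, currentB_eq]
  refine ⟨isConserved_coe α (conserved_A α), isConserved_coe α (conserved_B α), ?_, ?_, ?_⟩
  · have h := isCharacteristicOf_coe α (densityA α) (fluxA α)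
    rw [euler_densityA] at h
    exact h
  · have h := isCharacteristicOf_coe α (densityB α) fluxB
    rw [euler_densityB] at h
    exact h
  · intro hα J hJ
    obtain ⟨f, g, rfl, h⟩ := hJ.exists_eq
    obtain ⟨a, b, hχ⟩ := (isCosymmetry_of_conserved h).exists_eq hα
    -- The difference from the combination with the same characteristic is conserved and has
    -- characteristic zero, so it admits a potential.
    have h1 : totalT α (f + -(a • densityA α + b • densityB α)) +
        totalX (g + -(a • fluxA α + b • fluxB)) = 0 := by
      simp only [map_add, map_neg, Derivation.map_smul]
      have h2 := congrArg (a • ·) (conserved_A α)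
      have h3 := congrArg (b • ·) (conserved_B α)
      simp only [smul_add, smul_zero] at h2 h3
      linear_combination h - h2 - h3
    obtain ⟨L, hL1, hL2⟩ := exists_potential h1 (by
      rw [euler_add isDerivativeTower_ut, euler_neg isDerivativeTower_ut,
        euler_add isDerivativeTower_ut, euler_smul isDerivativeTower_ut,
        euler_smul isDerivativeTower_ut, euler_densityA, euler_densityB, hχ, add_neg_cancel])
    refine ⟨a, b, L.1, L.2, ?_, ?_⟩
    · rw [← coe_totalX]
      refine Eq.trans ?_ (congrArg Subtype.val hL1)
      exact sub_eq_add_neg _ _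
    · rw [← coe_totalT]
      refine Eq.trans ?_ (congrArg Subtype.val hL2)
      exact sub_eq_add_neg _ _
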